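/- **Setting.** Let $e$ be a type with a lawful `Eq` instance ($==$ is an equivalence relation, not necessarily identity) and a lawful `Ord` instance ($\le$ is total, transitive, and antisymmetric up to $==$; `compare`, $<$, $>$, $\ge$ agree with $\le$ and $==$). A *set* is a tree that is either $\mathtt{Tip}$ or $\mathtt{Bin}\ sz\ x\ l\ r$ with stored size $sz\in\mathbb Z$ (Haskell's `Int` is read as $\mathbb Z$), element $x$ and subtrees $l,r$; $\mathrm{size}\,\mathtt{Tip}=0$ and $\mathrm{size}(\mathtt{Bin}\ sz\ x\ l\ r)=sz$. Its denotation is $\mathrm{sem}\,\mathtt{Tip}\,i=\mathrm{false}$, $\mathrm{sem}(\mathtt{Bin}\ sz\ x\ l\ r)\,i=\mathrm{sem}\,l\,i\vee i==x\vee\mathrm{sem}\,r\,i$. A bound is an element or $\mathrm{None}$ (no bound). Let $\mathrm{bal}(s_1,s_2)$ mean $s_1+s_2\le1\vee(s_1\le\delta s_2\wedge s_2\le\delta s_1)$ with $\delta=3$. $\mathrm{Bounded}\ s\ lb\ ub$ is defined inductively: it holds for $\mathtt{Tip}$, and for $\mathtt{Bin}\ sz\ x\ l\ r$ if $\mathrm{Bounded}\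 l\ lb\ x$, $\mathrm{Bounded}\ r\ x\ ub$, $lb<x<ub$, $sz=1+\mathrm{size}\,l+\mathrm{size}\,r$ and $\mathrm{bal}(\mathrm{size}\,l,\mathrm{size}\,r)$. Put $\mathrm{WF}\,s:\Leftrightarrow\mathrm{Bounded}\ s\ \mathrm{None}\ \mathrm{None}$ and $$\mathrm{Desc}\ s\ lb\ ub\ sz\ f\ :\Leftrightarrow\ \mathrm{Bounded}\ s\ lb\ ub\ \wedge\ \mathrm{size}\,s=sz\ \wedge\ \forall i,\ \mathrm{sem}\,s\,i=f\,i .$$ Consider the functions of Haskell's `Data.Set` (containers 0.5.11.0) named below, as implemented there. Pointer equality is an arbitrary function of which it is only known that the answer true implies equality, and the results of calls of `error` are arbitrary; the claims hold for every choice of these. All functions terminate (for the four functions `from…List`, whose recursion is not structural, this is an explicit part of the claim). Write $L(s)$ for `toAscList s`. "Separated by $x$" means $\mathrm{Bounded}\ s_1\ lb\ x$, $\mathrm{Bounded}\ s_2\ x\ ub$ and $lb<x<ub$. **Theorem.** For all elements $x$, sets, bounds $lb,ub$, predicates $p$ and integers $n$: 1. *Queries.* $\mathrm{WF}\,s\Leftrightarrow$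 `valid s` $=$ true. For well-formed sets: `member x s` $=\mathrm{sem}\,s\,x$ and `notMember x s` is its negation; `null s` iff $\mathrm{sem}\,s$ is identically false; `size s` is the length of $L(s)$; `lookupMin s` (`lookupMax s`) is `Nothing` iff $\mathrm{sem}\,s$ is identically false, and otherwise a least (greatest) element of $s$; `disjoint` and `isSubsetOf` decide disjointness and inclusion of the denotations. 2. *Lists and folds.* For well-formed $s$, $L(s)$ is strictly increasing with membership (up to $==$) $\mathrm{sem}\,s$; `toDescList s` is its reverse, strictly decreasing, with the same membership; `toList` and `elems` return $L(s)$; `foldr`, `foldr'`, `foldl`, `foldl'` are the corresponding folds of $L(s)$. 3. *Construction and insertion.* $\mathrm{Desc}\ \mathtt{empty}\ lb\ ub\ 0\ (\lambda i.\,\mathrm{false})$. If $lb<x<ub$: $\mathrm{Desc}\ (\mathtt{singleton}\ x)\ lb\ ub\ 1\ (\lambda i.\,i==x)$; if also $\mathrm{Bounded}\ s\ lb\ ub$, then $\mathrm{Desc}\ (\mathtt{insert}\ x\ s)\ lb\ ub\ (\text{if }\mathrm{sem}\,s\,x\text{ then }\mathrm{size}\,s\text{ else }1+\mathrm{size}\,s)\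 (\lambda i.\,i==x\vee\mathrm{sem}\,s\,i)$, and likewise for `insertR`. If $\mathrm{Bounded}\ s\ lb\ x$ (resp. $\mathrm{Bounded}\ s\ x\ ub$) and $lb<x<ub$, then `insertMax x s` (resp. `insertMin x s`) has bounds $lb,ub$, size $1+\mathrm{size}\,s$ and denotation $\mathrm{sem}\,s\,i\vee i==x$. 4. *Deletion.* If $\mathrm{Bounded}\ s\ lb\ ub$, then `delete x s` has bounds $lb,ub$, size $\mathrm{size}\,s-1$ if $\mathrm{sem}\,s\,x$ and $\mathrm{size}\,s$ otherwise, and denotation $\neg(i==x)\wedge\mathrm{sem}\,s\,i$. If `lookupMin s` is $m$, then `deleteMin s` has bounds $lb,ub$, size $\mathrm{size}\,s-1$ and denotation $\neg(i==m)\wedge\mathrm{sem}\,s\,i$; if it is `Nothing`, the result describes the empty set. Likewise `deleteMax` with `lookupMax`. `minView s` is `Nothing` iff $\mathrm{sem}\,s$ is identically false; if it is $(m,t)$, then $\mathrm{sem}\,s\,m$, $lb<m<ub$ and $\mathrm{Desc}\ t\ m\ ub\ (\mathrm{size}\,s-1)\ (\lambda i.\,\neg(i==m)\wedge\mathrm{sem}\,s\,i)$;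 `maxView` likewise with bounds $lb,m$. `minViewSure x l r` and `maxViewSure x l r` satisfy the same for $s=\mathtt{Bin}\ sz\ x\ l\ r$, with size $\mathrm{size}\,l+\mathrm{size}\,r$. 5. *Balancing and joining.* Let $s_1,s_2$ be separated by $x$, $a=\mathrm{size}\,s_1$, $b=\mathrm{size}\,s_2$, and $\mathrm{bal}^*(a,b):\Leftrightarrow\delta a\le\delta^2b+\delta b+b\wedge b\le a$. Then $\mathrm{Desc}\ (\mathtt{link}\ x\ s_1\ s_2)\ lb\ ub\ (1+a+b)\ (\lambda i.\,\mathrm{sem}\,s_1\,i\vee i==x\vee\mathrm{sem}\,s_2\,i)$ and $\mathrm{Desc}\ (\mathtt{merge}\ s_1\ s_2)\ lb\ ub\ (a+b)\ (\lambda i.\,\mathrm{sem}\,s_1\,i\vee\mathrm{sem}\,s_2\,i)$. If $\mathrm{bal}(a,b)$, `glue s1 s2` satisfies the same as `merge s1 s2`. If $(\mathrm{bal}^*(a-1,b)\wedge0<a)\vee\mathrm{bal}(a,b)\vee\mathrm{bal}(a,b+1)$, then `balanceL x s1 s2` satisfies the same as `link x s1 s2`; if $(\mathrm{bal}^*(b-1,a)\wedge0<b)\vee\mathrm{bal}(a,b)\vee\mathrm{bal}(a+1,b)$,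 so does `balanceR x s1 s2`. 6. *Splitting.* If $\mathrm{Bounded}\ s\ lb\ ub$ and `split x s` $=(s_1,s_2)$, then $\mathrm{Bounded}\ s_1\ lb\ x$, $\mathrm{Bounded}\ s_2\ x\ ub$, and $s_1$ (resp. $s_2$) has bounds $lb,ub$, denotation $i<x\wedge\mathrm{sem}\,s\,i$ (resp. $i>x\wedge\mathrm{sem}\,s\,i$) and as size the number of entries of $L(s)$ that are $<x$ (resp. $>x$). `splitMember x s` $=(s_1,b,s_2)$ satisfies the same and $b=\mathrm{sem}\,s\,x$. 7. *Set operations.* If $s_1,s_2$ both have bounds $lb,ub$, then so does `union s1 s2`, with denotation $\mathrm{sem}\,s_1\,i\vee\mathrm{sem}\,s_2\,i$ and size $\mathrm{size}\,s_1$ plus the number of entries of $L(s_2)$ not in $s_1$. If all sets of a list have bounds $lb,ub$, then so does their `unions`, whose denotation is the disjunction of theirs and whose size is the number of their elements up to $==$. If $s_1$ has bounds $lb,ub$ and $s_2$ is well-formed, then `difference s1 s2` and `intersection s1 s2` have bounds $lb,ub$, denotations $\mathrm{sem}\,s_1\,i\wedge\neg\mathrm{sem}\,s_2\,i$ and $\mathrm{sem}\,s_1\,i\wedge\mathrm{sem}\,s_2\,i$,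 and as sizes the numbers of entries of $L(s_1)$ not in $s_2$, resp. in $s_2$. 8. *Filtering and mapping.* If $\mathrm{Bounded}\ s\ lb\ ub$, then `filter p s` has bounds $lb,ub$ and its ascending list is the sublist of $L(s)$ of entries satisfying $p$; if $p$ takes equal values on elements that are $==$, then its size is the number of these entries and its denotation is $p\,i\wedge\mathrm{sem}\,s\,i$. `partition p s` is a pair of sets satisfying this for $p$ and for $\neg p$. If $f:e\to e'$ is strictly increasing ($e'$ lawful as well), then `mapMonotonic f s` has ascending list $\mathrm{map}\,f\,L(s)$, the bounds $f(lb),f(ub)$, size $\mathrm{size}\,s$ and as denotation membership in $\mathrm{map}\,f\,L(s)$; if $f$ also preserves $==$, then $\mathrm{sem}(\mathtt{mapMonotonic}\ f\ s)(f\,i)=\mathrm{sem}\,s\,i$. 9. *Positions.* If $\mathrm{Bounded}\ s\ lb\ ub$, then `take n s` and `drop n s` have bounds $lb,ub$; their ascending lists are $L(s)$ restricted to, resp. without, its first $\max(0,n)$ entries; their sizes are $k=\max(0,\min(n,\mathrm{size}\,s))$ and $\mathrm{size}\,s-k$; their denotations are membership in these lists. `splitAt n s` is a pair of sets with these two descriptions.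 10. *Sorted lists.* For every list $xs$, `combineEq xs` is a sublist of $xs$ with the same membership up to $==$; it is strictly increasing (decreasing) if $xs$ is weakly increasing (decreasing). `fromDistinctAscList xs`, `fromDistinctDescList xs`, `fromAscList xs`, `fromDescList xs` terminate for every list $xs$. If $xs$ is, respectively, strictly increasing, strictly decreasing, weakly increasing, weakly decreasing, and all its entries lie strictly between $lb$ and $ub$, then the result has bounds $lb,ub$, the number of entries of $xs$ up to $==$ as its size (the length of $xs$ in the first two cases), and membership in $xs$ up to $==$ as its denotation; in the first two cases `toAscList`, resp. `toDescList`, of the result is $xs$. -/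

import Mathlib

/-! ## Ordered element types

Haskell's `Eq` is Lean's `BEq` (with `/=` being `!=`), and its laws are `EquivBEq`:
`==` is an equivalence relation, which need not be Lean's equality. -/

/-- The methods of Haskell's class `Ord` used by the set library. -/
class HsOrd (α : Type*) where
  compare : α → α → Ordering
  lt : α → α → Bool
  le : α → α → Bool
  gt : α → α → Bool
  ge : α → α → Bool

/-- The laws of a lawful `Ord` instance: `<=` is a linear order up to `==`, and the other
operations agree with `<=` and `==`. -/
class OrdLaws (α : Type*) [BEq α] [EquivBEq α] [HsOrd α] : Prop where
  antisymm : ∀ a b : α, HsOrd.le a b = true → HsOrd.le b a = true → (a == b) = true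
  trans_le : ∀ a b c : α, HsOrd.le a b = true → HsOrd.le b c = true → HsOrd.le a c = true
  total : ∀ a b : α, HsOrd.le a b = true ∨ HsOrd.le b a = true
  compare_lt : ∀ a b : α, HsOrd.compare a b = .lt ↔ HsOrd.le b a = false
  compare_eq : ∀ a b : α, HsOrd.compare a b = .eq ↔ (a == b) = true
  compare_gt : ∀ a b : α, HsOrd.compare a b = .gt ↔ HsOrd.le a b = false
  lt_le : ∀ a b : α, HsOrd.lt a b = !HsOrd.le b a
  ge_le : ∀ a b : α, HsOrd.ge a b = HsOrd.le b a
  gt_le : ∀ a b : α, HsOrd.gt a b = !HsOrd.le a b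

/-- Weight-balanced trees; the first component of `bin` is the stored size. Haskell's `Int`
is translated to the unbounded integers. -/
inductive HSet (e : Type*) where
  | bin : ℤ → e → HSet e → HSet e → HSet e
  | tip : HSet e

/-- The two unspecified primitives used by the library. `ptrEqElem` and `ptrEqSet` are pointer equality (on elements
and on sets): they may return `false` at will, and all that is known about them is that `true`
implies equality. `errorL` and `errorR` are the values of the calls of `error` in `balanceL` and
`balanceR`; nothing is known about them. All results are stated for every choice of these. -/
class HsPrims (e : Type*) where
  ptrEqElem : e → e → Bool
  eq_of_ptrEqElem : ∀ x y : e, ptrEqElem x y = true → x = y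
  ptrEqSet : HSet e → HSet e → Bool
  eq_of_ptrEqSet : ∀ s t : HSet e, ptrEqSet s t = true → s = t
  errorL : HSet e
  errorR : HSet e

namespace HSet

open HsPrims

section Code

variable {e : Type*}

/-! ## The library code -/

/-- The balance parameter `δ`. -/
def delta : ℤ := 3

/-- The rotation parameter, deciding between a single and a double rotation. -/
def ratio : ℤ := 2

def empty : HSet e := tip

def singleton (x : e) : HSet e := bin 1 x tip tip

def null : HSet e → Bool
  | tip => true
  | bin _ _ _ _ => false

/-- The stored size. -/
def size : HSet e → ℤ
  | tip => 0
  | bin sz _ _ _ => sz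

/-- Makes a node from subtrees that are already balanced. -/
def mkBin (x : e) (l r : HSet e) : HSet e := bin (size l + size r + 1) x l r

/-! ### Queries -/

def member [HsOrd e] (x : e) : HSet e → Bool
  | tip => false
  | bin _ y l r =>
    match HsOrd.compare x y with
    | .lt => member x l
    | .gt => member x r
    | .eq => true

def notMember [HsOrd e] (x : e) (s : HSet e) : Bool := !member x s

def lookupMinSure : e → HSet e → e
  | x, tip => x
  | _, bin _ x l _ => lookupMinSure x l

def lookupMin : HSet e → Option e
  | tip => none
  | bin _ x l _ => some (lookupMinSure x l)

def lookupMaxSure : e → HSet e → e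
  | x, tip => x
  | _, bin _ x _ r => lookupMaxSure x r

def lookupMax : HSet e → Option e
  | tip => none
  | bin _ x _ r => some (lookupMaxSure x r)

/-! ### Folds and conversion to lists -/

def foldr {β : Type*} (f : e → β → β) : β → HSet e → β
  | z, tip => z
  | z, bin _ x l r => foldr f (f x (foldr f z r)) l

def foldl {β : Type*} (f : β → e → β) : β → HSet e → β
  | z, tip => z
  | z, bin _ x l r => foldl f (f (foldl f z l) x) r

/-- Strict variant of `foldr`; strictness is invisible here. -/
def foldr' {β : Type*} (f : e → β → β) : β → HSet e → β
  | z, tip => z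
  | z, bin _ x l r =>
    let z' := foldr' f z r
    foldr' f (f x z') l

/-- Strict variant of `foldl`; strictness is invisible here. -/
def foldl' {β : Type*} (f : β → e → β) : β → HSet e → β
  | z, tip => z
  | z, bin _ x l r =>
    let z' := foldl' f z l
    foldl' f (f z' x) r

def toAscList (s : HSet e) : List e := foldr List.cons [] s

def toDescList (s : HSet e) : List e := foldl (fun xs x => x :: xs) [] s

def toList (s : HSet e) : List e := toAscList s

def elems (s : HSet e) : List e := toAscList s

/-! ### Balancing -/

/-- Rebalances when the left subtree may be too big. -/
def balanceL [HsPrims e] (x : e) (l r : HSet e) : HSet e :=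
  match r with
  | tip =>
    match l with
    | tip => bin 1 x tip tip
    | bin _ _ tip tip => bin 2 x l tip
    | bin _ lx tip (bin _ lrx _ _) => bin 3 lrx (bin 1 lx tip tip) (bin 1 x tip tip)
    | bin _ lx (bin lls llx lll llr) tip =>
      bin 3 lx (bin lls llx lll llr) (bin 1 x tip tip)
    | bin ls lx (bin lls llx lll llr) (bin lrs lrx lrl lrr) =>
      if lrs < ratio * lls then
        bin (1 + ls) lx (bin lls llx lll llr) (bin (1 + lrs) x (bin lrs lrx lrl lrr) tip)
      else
        bin (1 + ls) lrx (bin (1 + lls + size lrl) lx (bin lls llx lll llr) lrl)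
          (bin (1 + size lrr) x lrr tip)
  | bin rs _ _ _ =>
    match l with
    | tip => bin (1 + rs) x tip r
    | bin ls lx ll lr =>
      if ls > delta * rs then
        match ll, lr with
        | bin lls _ _ _, bin lrs lrx lrl lrr =>
          if lrs < ratio * lls then
            bin (1 + ls + rs) lx ll (bin (1 + rs + lrs) x lr r)
          else
            bin (1 + ls + rs) lrx (bin (1 + lls + size lrl) lx ll lrl)
              (bin (1 + rs + size lrr) x lrr r)
        | _, _ => errorL
      else bin (1 + ls + rs) x l r

/-- Rebalances when the right subtree may be too big. -/
def balanceR [HsPrims e] (x : e) (l r : HSet e) : HSet e :=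
  match l with
  | tip =>
    match r with
    | tip => bin 1 x tip tip
    | bin _ _ tip tip => bin 2 x tip r
    | bin _ rx tip (bin rrs rrx rrl rrr) =>
      bin 3 rx (bin 1 x tip tip) (bin rrs rrx rrl rrr)
    | bin _ rx (bin _ rlx _ _) tip => bin 3 rlx (bin 1 x tip tip) (bin 1 rx tip tip)
    | bin rs rx (bin rls rlx rll rlr) (bin rrs rrx rrl rrr) =>
      if rls < ratio * rrs then
        bin (1 + rs) rx (bin (1 + rls) x tip (bin rls rlx rll rlr)) (bin rrs rrx rrl rrr)
      else
        bin (1 + rs) rlx (bin (1 + size rll) x tip rll)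
          (bin (1 + rrs + size rlr) rx rlr (bin rrs rrx rrl rrr))
  | bin ls _ _ _ =>
    match r with
    | tip => bin (1 + ls) x l tip
    | bin rs rx rl rr =>
      if rs > delta * ls then
        match rl, rr with
        | bin rls rlx rll rlr, bin rrs _ _ _ =>
          if rls < ratio * rrs then
            bin (1 + ls + rs) rx (bin (1 + ls + rls) x l rl) rr
          else
            bin (1 + ls + rs) rlx (bin (1 + ls + size rll) x l rll)
              (bin (1 + rrs + size rlr) rx rlr rr)
        | _, _ => errorR
      else bin (1 + ls + rs) x l r

/-! ### Insertion, deletion, minimum and maximum -/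

def insert [HsOrd e] [HsPrims e] (x : e) : HSet e → HSet e
  | tip => singleton x
  | bin sz y l r =>
    match HsOrd.compare x y with
    | .lt =>
      let l' := insert x l
      if ptrEqSet l' l then bin sz y l r else balanceL y l' r
    | .gt =>
      let r' := insert x r
      if ptrEqSet r' r then bin sz y l r else balanceR y l r'
    | .eq => if ptrEqElem x y then bin sz y l r else bin sz x l r

/-- Like `insert`, but keeps an equal element that is already present. -/
def insertR [HsOrd e] [HsPrims e] (x : e) : HSet e → HSet e
  | tip => singleton x
  | bin sz y l r =>
    match HsOrd.compare x y with
    | .lt =>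
      let l' := insertR x l
      if ptrEqSet l' l then bin sz y l r else balanceL y l' r
    | .gt =>
      let r' := insertR x r
      if ptrEqSet r' r then bin sz y l r else balanceR y l r'
    | .eq => bin sz y l r

def insertMax [HsPrims e] (x : e) : HSet e → HSet e
  | tip => singleton x
  | bin _ y l r => balanceR y l (insertMax x r)

def insertMin [HsPrims e] (x : e) : HSet e → HSet e
  | tip => singleton x
  | bin _ y l r => balanceL y (insertMin x l) r

/-- Minimum and remainder of the nonempty set with root `x` and subtrees `l` and `r`. -/
def minViewSure [HsPrims e] (x : e) : HSet e → HSet e → e × HSet e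
  | tip, r => (x, r)
  | bin _ xl ll lr, r =>
    let p := minViewSure xl ll lr
    (p.1, balanceR x p.2 r)

/-- Maximum and remainder of the nonempty set with root `x` and subtrees `l` and `r`. -/
def maxViewSure [HsPrims e] (x : e) : HSet e → HSet e → e × HSet e
  | l, tip => (x, l)
  | l, bin _ xr rl rr =>
    let p := maxViewSure xr rl rr
    (p.1, balanceL x l p.2)

def minView [HsPrims e] : HSet e → Option (e × HSet e)
  | tip => none
  | bin _ x l r => some (minViewSure x l r)

def maxView [HsPrims e] : HSet e → Option (e × HSet e)
  | tip => none
  | bin _ x l r => some (maxViewSure x l r)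

def deleteMin [HsPrims e] : HSet e → HSet e
  | bin _ _ tip r => r
  | bin _ x (bin ls lx ll lr) r => balanceR x (deleteMin (bin ls lx ll lr)) r
  | tip => tip

def deleteMax [HsPrims e] : HSet e → HSet e
  | bin _ _ l tip => l
  | bin _ x l (bin rs rx rl rr) => balanceL x l (deleteMax (bin rs rx rl rr))
  | tip => tip

/-- Joins two sets that are separated and balanced with respect to each other. -/
def glue [HsPrims e] : HSet e → HSet e → HSet e
  | tip, r => r
  | bin sl xl ll lr, tip => bin sl xl ll lr
  | bin sl xl ll lr, bin sr xr rl rr =>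
    if sl > sr then
      let p := maxViewSure xl ll lr
      balanceR p.1 p.2 (bin sr xr rl rr)
    else
      let p := minViewSure xr rl rr
      balanceL p.1 (bin sl xl ll lr) p.2

def delete [HsOrd e] [HsPrims e] (x : e) : HSet e → HSet e
  | tip => tip
  | bin sz y l r =>
    match HsOrd.compare x y with
    | .lt =>
      let l' := delete x l
      if ptrEqSet l' l then bin sz y l r else balanceR y l' r
    | .gt =>
      let r' := delete x r
      if ptrEqSet r' r then bin sz y l r else balanceL y l r'
    | .eq => glue l r

/-! ### Joining and splitting -/

/-- Joins two separated sets of arbitrary sizes with an element in between. -/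
def link [HsPrims e] (x : e) : HSet e → HSet e → HSet e
  | tip, r => insertMin x r
  | bin sl y ly ry, tip => insertMax x (bin sl y ly ry)
  | bin sl y ly ry, bin sr z lz rz =>
    if delta * sl < sr then balanceL z (link x (bin sl y ly ry) lz) rz
    else if delta * sr < sl then balanceR y ly (link x ry (bin sr z lz rz))
    else mkBin x (bin sl y ly ry) (bin sr z lz rz)
termination_by l r => sizeOf l + sizeOf r

/-- Joins two separated sets of arbitrary sizes. -/
def merge [HsPrims e] : HSet e → HSet e → HSet e
  | tip, r => r
  | bin sl x lx rx, tip => bin sl x lx rx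
  | bin sl x lx rx, bin sr y ly ry =>
    if delta * sl < sr then balanceL y (merge (bin sl x lx rx) ly) ry
    else if delta * sr < sl then balanceR x lx (merge rx (bin sr y ly ry))
    else glue (bin sl x lx rx) (bin sr y ly ry)
termination_by l r => sizeOf l + sizeOf r

def splitS [HsOrd e] [HsPrims e] (x : e) : HSet e → HSet e × HSet e
  | tip => (tip, tip)
  | bin _ y l r =>
    match HsOrd.compare x y with
    | .lt =>
      let p := splitS x l
      (p.1, link y p.2 r)
    | .gt =>
      let p := splitS x r
      (link y l p.1, p.2)
    | .eq => (l, r)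

def split [HsOrd e] [HsPrims e] (x : e) (s : HSet e) : HSet e × HSet e := splitS x s

def splitMember [HsOrd e] [HsPrims e] (x : e) : HSet e → HSet e × Bool × HSet e
  | tip => (tip, false, tip)
  | bin _ y l r =>
    match HsOrd.compare x y with
    | .lt =>
      let p := splitMember x l
      (p.1, p.2.1, link y p.2.2 r)
    | .gt =>
      let p := splitMember x r
      (link y l p.1, p.2.1, p.2.2)
    | .eq => (l, true, r)

/-! ### Set operations -/

def union [HsOrd e] [HsPrims e] : HSet e → HSet e → HSet e
  | t1, tip => t1
  | t1, bin _ x tip tip => insertR x t1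
  | bin _ x tip tip, t2 => insert x t2
  | tip, t2 => t2
  | bin s1 x l1 r1, t2 =>
    let p := splitS x t2
    let l1l2 := union l1 p.1
    let r1r2 := union r1 p.2
    if ptrEqSet l1l2 l1 && ptrEqSet r1r2 r1 then bin s1 x l1 r1 else link x l1l2 r1r2

def unions [HsOrd e] [HsPrims e] (ss : List (HSet e)) : HSet e := ss.foldl union empty

def difference [HsOrd e] [HsPrims e] : HSet e → HSet e → HSet e
  | tip, _ => tip
  | t1, tip => t1
  | t1, bin _ x l2 r2 =>
    let p := split x t1
    let l1l2 := difference p.1 l2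
    let r1r2 := difference p.2 r2
    if size l1l2 + size r1r2 = size t1 then t1 else merge l1l2 r1r2

def intersection [HsOrd e] [HsPrims e] : HSet e → HSet e → HSet e
  | tip, _ => tip
  | _, tip => tip
  | bin s1 x l1 r1, t2 =>
    let p := splitMember x t2
    let l1l2 := intersection l1 p.1
    let r1r2 := intersection r1 p.2.2
    if p.2.1 then
      if ptrEqSet l1l2 l1 && ptrEqSet r1r2 r1 then bin s1 x l1 r1 else link x l1l2 r1r2
    else merge l1l2 r1r2

def disjoint [HsOrd e] [HsPrims e] : HSet e → HSet e → Bool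
  | _, tip => true
  | tip, _ => true
  | bin _ x l r, t =>
    let p := splitMember x t
    !p.2.1 && disjoint l p.1 && disjoint r p.2.2

def isSubsetOfX [HsOrd e] [HsPrims e] : HSet e → HSet e → Bool
  | tip, _ => true
  | _, tip => false
  | bin _ x l r, t =>
    let p := splitMember x t
    p.2.1 && isSubsetOfX l p.1 && isSubsetOfX r p.2.2

def isSubsetOf [HsOrd e] [HsPrims e] (t1 t2 : HSet e) : Bool :=
  decide (size t1 ≤ size t2) && isSubsetOfX t1 t2

def filter [HsPrims e] (p : e → Bool) : HSet e → HSet e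
  | tip => tip
  | bin sz x l r =>
    let l' := filter p l
    let r' := filter p r
    if p x then
      if ptrEqSet l l' && ptrEqSet r r' then bin sz x l r else link x l' r'
    else merge l' r'

def partition [HsPrims e] (p : e → Bool) : HSet e → HSet e × HSet e
  | tip => (tip, tip)
  | bin sz x l r =>
    let pl := partition p l
    let pr := partition p r
    if p x then
      (if ptrEqSet pl.1 l && ptrEqSet pr.1 r then bin sz x l r else link x pl.1 pr.1,
        merge pl.2 pr.2)
    else
      (merge pl.1 pr.1,
        if ptrEqSet pl.2 l && ptrEqSet pr.2 r then bin sz x l r else link x pl.2 pr.2)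

def mapMonotonic {e' : Type*} (f : e → e') : HSet e → HSet e'
  | tip => tip
  | bin sz x l r => bin sz (f x) (mapMonotonic f l) (mapMonotonic f r)

/-! ### Operations by position -/

def takeGo [HsPrims e] : ℤ → HSet e → HSet e
  | i, m =>
    if i ≤ 0 then tip
    else
      match m with
      | tip => tip
      | bin _ x l r =>
        match compare i (size l) with
        | .lt => takeGo i l
        | .gt => link x l (takeGo (i - size l - 1) r)
        | .eq => l

def take [HsPrims e] (i : ℤ) (m : HSet e) : HSet e := if i ≥ size m then m else takeGo i m

def dropGo [HsPrims e] : ℤ → HSet e → HSet e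
  | i, m =>
    if i ≤ 0 then m
    else
      match m with
      | tip => tip
      | bin _ x l r =>
        match compare i (size l) with
        | .lt => link x (dropGo i l) r
        | .gt => dropGo (i - size l - 1) r
        | .eq => insertMin x r

def drop [HsPrims e] (i : ℤ) (m : HSet e) : HSet e := if i ≥ size m then tip else dropGo i m

def splitAtGo [HsPrims e] : ℤ → HSet e → HSet e × HSet e
  | i, m =>
    if i ≤ 0 then (tip, m)
    else
      match m with
      | tip => (tip, tip)
      | bin _ x l r =>
        match compare i (size l) with
        | .lt =>
          let p := splitAtGo i l
          (p.1, link x p.2 r)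
        | .gt =>
          let p := splitAtGo (i - size l - 1) r
          (link x l p.1, p.2)
        | .eq => (l, insertMin x r)

def splitAt [HsPrims e] (i : ℤ) (m : HSet e) : HSet e × HSet e :=
  if i ≥ size m then (m, tip) else splitAtGo i m

/-! ### Conversion from sorted lists

The recursions of these functions are not structural, and some of their local functions diverge on
some arguments. They are therefore run with a bound on the recursion depth, their first argument;
`none` means that the bound was hit. -/

/-- The computation whose depth-bounded runs are `f` terminates with result `a`. -/
def Returns {α : Type*} (f : ℕ → Option α) (a : α) : Prop := ∃ N, ∀ n, N ≤ n → f n = some a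

def createAsc [HsPrims e] : ℕ → ℤ → List e → Option (HSet e × List e)
  | 0, _, _ => none
  | _ + 1, _, [] => some (tip, [])
  | n + 1, s, x :: xs' =>
    if s = 1 then some (bin 1 x tip tip, xs')
    else
      match createAsc n (s >>> (1 : ℕ)) (x :: xs') with
      | none => none
      | some (l, []) => some (l, [])
      | some (l, y :: ys) =>
        match createAsc n (s >>> (1 : ℕ)) ys with
        | none => none
        | some (r, zs) => some (link y l r, zs)

def goAsc [HsPrims e] : ℕ → ℤ → HSet e → List e → Option (HSet e)
  | 0, _, _, _ => none
  | _ + 1, _, l, [] => some l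
  | n + 1, s, l, x :: xs =>
    match createAsc n s xs with
    | none => none
    | some (r, ys) => goAsc n (s <<< (1 : ℕ)) (link x l r) ys

def fromDistinctAscList [HsPrims e] (n : ℕ) : List e → Option (HSet e)
  | [] => some tip
  | x :: xs => goAsc n 1 (bin 1 x tip tip) xs

def createDesc [HsPrims e] : ℕ → ℤ → List e → Option (HSet e × List e)
  | 0, _, _ => none
  | _ + 1, _, [] => some (tip, [])
  | n + 1, s, x :: xs' =>
    if s = 1 then some (bin 1 x tip tip, xs')
    else
      match createDesc n (s >>> (1 : ℕ)) (x :: xs') with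
      | none => none
      | some (r, []) => some (r, [])
      | some (r, y :: ys) =>
        match createDesc n (s >>> (1 : ℕ)) ys with
        | none => none
        | some (l, zs) => some (link y l r, zs)

def goDesc [HsPrims e] : ℕ → ℤ → HSet e → List e → Option (HSet e)
  | 0, _, _, _ => none
  | _ + 1, _, r, [] => some r
  | n + 1, s, r, x :: xs =>
    match createDesc n s xs with
    | none => none
    | some (l, ys) => goDesc n (s <<< (1 : ℕ)) (link x l r) ys

def fromDistinctDescList [HsPrims e] (n : ℕ) : List e → Option (HSet e)
  | [] => some tip
  | x :: xs => goDesc n 1 (bin 1 x tip tip) xs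

def combineEqGo [BEq e] : e → List e → List e
  | z, [] => [z]
  | z, y :: ys => if z == y then combineEqGo z ys else z :: combineEqGo y ys

/-- Keeps the first element of each block of adjacent equal elements. -/
def combineEq [BEq e] : List e → List e
  | [] => []
  | x :: xs => combineEqGo x xs

def fromAscList [BEq e] [HsPrims e] (n : ℕ) (xs : List e) : Option (HSet e) :=
  fromDistinctAscList n (combineEq xs)

def fromDescList [BEq e] [HsPrims e] (n : ℕ) (xs : List e) : Option (HSet e) :=
  fromDistinctDescList n (combineEq xs)

/-! ### The executable validity check -/

def balanced : HSet e → Bool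
  | tip => true
  | bin _ _ l r =>
    (decide (size l + size r ≤ 1) ||
      (decide (size l ≤ delta * size r) && decide (size r ≤ delta * size l))) &&
    balanced l && balanced r

def orderedGo [HsOrd e] (lo hi : e → Bool) : HSet e → Bool
  | tip => true
  | bin _ x l r =>
    lo x && hi x && orderedGo lo (fun y => HsOrd.lt y x) l && orderedGo (fun y => HsOrd.gt y x) hi r

def ordered [HsOrd e] (t : HSet e) : Bool := orderedGo (fun _ => true) (fun _ => true) t

def realsize : HSet e → Option ℤ
  | tip => some 0
  | bin sz _ l r =>
    match realsize l, realsize r with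
    | some n, some m => if n + m + 1 = sz then some sz else none
    | _, _ => none

def validsize (t : HSet e) : Bool := decide (realsize t = some (size t))

def valid [HsOrd e] (t : HSet e) : Bool := balanced t && ordered t && validsize t

end Code

section Spec

variable {e : Type*}

/-! ## Well-formedness, denotation and `Desc` -/

/-- If the lower bound `lb` is defined, it is less than `x`. -/
def isLB [HsOrd e] (lb : Option e) (x : e) : Bool :=
  match lb with
  | none => true
  | some b => HsOrd.lt b x

/-- If the upper bound `ub` is defined, it is greater than `x`. -/
def isUB [HsOrd e] (ub : Option e) (x : e) : Bool :=
  match ub with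
  | none => true
  | some b => HsOrd.lt x b

/-- The balance condition of Adams with parameter `δ = 3`. -/
def BalanceProp (s1 s2 : ℤ) : Prop :=
  s1 + s2 ≤ 1 ∨ (s1 ≤ delta * s2 ∧ s2 ≤ delta * s1)

/-- The auxiliary condition `bal*` used in the precondition of the balancing functions. -/
def BalanceStar (s1 s2 : ℤ) : Prop :=
  delta * s1 ≤ delta ^ 2 * s2 + delta * s2 + s2 ∧ s2 ≤ s1

/-- The tree is ordered, all its elements lie strictly between the bounds (`none` is unbounded),
the stored sizes are correct, and every node is balanced. -/
inductive Bounded [HsOrd e] : HSet e → Option e → Option e → Prop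
  | tip (lb ub : Option e) : Bounded tip lb ub
  | bin (lb ub : Option e) (s1 s2 : HSet e) (x : e) (sz : ℤ) :
      Bounded s1 lb (some x) →
      Bounded s2 (some x) ub →
      isLB lb x = true →
      isUB ub x = true →
      sz = 1 + size s1 + size s2 →
      BalanceProp (size s1) (size s2) →
      Bounded (bin sz x s1 s2) lb ub

/-- Well-formed sets. -/
def WF [HsOrd e] (s : HSet e) : Prop := Bounded s none none

/-- The denotation of a set: its indicator function. -/
def sem [BEq e] : HSet e → e → Bool
  | bin _ x s1 s2, i => sem s1 i || i == x || sem s2 i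
  | tip, _ => false

/-- Complete description of a set by its bounds, its size and its denotation. -/
def Desc [BEq e] [HsOrd e] (s : HSet e) (lb ub : Option e) (sz : ℤ) (f : e → Bool) : Prop :=
  Bounded s lb ub ∧ size s = sz ∧ ∀ i, sem s i = f i

/-- The predicate `p` does not distinguish elements that are equal with respect to `==`. -/
def Respects [BEq e] (p : e → Bool) : Prop := ∀ x y : e, (x == y) = true → p x = p y

/-- The number of elements of a list up to `==`. -/
def distinctCount [BEq e] (xs : List e) : ℤ :=
  ((xs.pwFilter fun a b => (a == b) = false).length : ℤ)

end Spec

end HSet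

namespace HSet

open HsPrims

section Structure

variable {e : Type*}

/-! ## Ascending lists and folds -/

theorem foldr_cons_eq_append (z : List e) (s : HSet e) :
    foldr List.cons z s = toAscList s ++ z := by
  induction s generalizing z with
  | tip => rfl
  | bin sz x l r ihl ihr =>
    simp only [toAscList, foldr] at *
    rw [ihl, ihr z, ihl (x :: _)]
    simp

@[simp] theorem toAscList_tip : toAscList (tip : HSet e) = [] := rfl

@[simp] theorem toAscList_bin (sz : ℤ) (x : e) (l r : HSet e) :
    toAscList (bin sz x l r) = toAscList l ++ x :: toAscList r :=
  foldr_cons_eq_append _ l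

theorem foldr_eq {β : Type*} (f : e → β → β) (z : β) (s : HSet e) :
    foldr f z s = (toAscList s).foldr f z := by
  induction s generalizing z <;> simp_all [foldr]

theorem foldr'_eq {β : Type*} (f : e → β → β) (z : β) (s : HSet e) :
    foldr' f z s = (toAscList s).foldr f z := by
  induction s generalizing z <;> simp_all [foldr']

theorem foldl_eq {β : Type*} (f : β → e → β) (z : β) (s : HSet e) :
    foldl f z s = (toAscList s).foldl f z := by
  induction s generalizing z <;> simp_all [foldl]

theorem foldl'_eq {β : Type*} (f : β → e → β) (z : β) (s : HSet e) :
    foldl' f z s = (toAscList s).foldl f z := by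
  induction s generalizing z <;> simp_all [foldl']

theorem toDescList_eq_reverse (s : HSet e) : toDescList s = (toAscList s).reverse := by
  simp [toDescList, foldl_eq]

@[simp] theorem size_tip : size (tip : HSet e) = 0 := rfl

@[simp] theorem size_bin (sz : ℤ) (x : e) (l r : HSet e) : size (bin sz x l r) = sz := rfl

/-! ## Weight balance -/

/-- The stored sizes are correct and every node is balanced. -/
def WeightBalanced : HSet e → Prop
  | tip => True
  | bin sz _ l r =>
    sz = 1 + size l + size r ∧ BalanceProp (size l) (size r) ∧ WeightBalanced l ∧ WeightBalanced r

theorem WeightBalanced.size_eq {s : HSet e} (h : WeightBalanced s) :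
    size s = ((toAscList s).length : ℤ) := by
  induction s with
  | tip => rfl
  | bin sz x l r ihl ihr =>
    obtain ⟨h1, -, h2, h3⟩ := h
    simp only [size_bin, toAscList_bin, List.length_append, List.length_cons, h1, ihl h2, ihr h3]
    push_cast
    ring

theorem WeightBalanced.size_nonneg {s : HSet e} (h : WeightBalanced s) : 0 ≤ size s := by
  rw [h.size_eq]; positivity

theorem WeightBalanced.eq_tip {s : HSet e} (h : WeightBalanced s) (h0 : size s ≤ 0) : s = tip := by
  cases s with
  | tip => rfl
  | bin sz x l r =>
    obtain ⟨h1, -, h2, h3⟩ := h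
    have := h2.size_nonneg
    have := h3.size_nonneg
    simp only [size_bin] at h0
    omega

theorem weightBalanced_singleton (x : e) : WeightBalanced (bin 1 x tip tip) := by
  simp [WeightBalanced, BalanceProp]

variable [HsPrims e]

theorem balanceL_spec {x : e} {l r : HSet e} (hl : WeightBalanced l) (hr : WeightBalanced r)
    (h : (BalanceStar (size l - 1) (size r) ∧ 0 < size l) ∨ BalanceProp (size l) (size r) ∨
      BalanceProp (size l) (size r + 1)) :
    WeightBalanced (balanceL x l r) ∧
      toAscList (balanceL x l r) = toAscList l ++ x :: toAscList r := by
  have nn : ∀ {s : HSet e}, WeightBalanced s → 0 ≤ size s := WeightBalanced.size_nonneg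
  rcases r with ⟨rs, rx, rl, rr⟩ | _
  · rcases l with ⟨ls, lx, ll, lr⟩ | _
    · obtain ⟨h1, h2, h3, h4⟩ := hl
      have hr' := hr
      obtain ⟨h5, -, h6, h7⟩ := hr'
      have := nn h3; have := nn h4; have := nn h6; have := nn h7
      by_cases hd : ls > delta * rs
      · rcases hl0 : ll with ⟨lls, llx, lll, llr⟩ | _ <;>
          rcases hr0 : lr with ⟨lrs, lrx, lrl, lrr⟩ | _ <;> subst hl0 hr0
        · have h3' := h3
          have h4' := h4
          obtain ⟨-, -, h8, h9⟩ := h3'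
          obtain ⟨-, -, h10, h11⟩ := h4'
          have := nn h8; have := nn h9; have := nn h10; have := nn h11
          simp only [balanceL, hd, if_true]
          split_ifs <;> refine ⟨?_, by simp⟩ <;>
            simp only [WeightBalanced, size_bin, BalanceProp, BalanceStar, delta, ratio] at * <;>
            simp only [*, and_true, true_and] <;> omega
        all_goals
          simp only [WeightBalanced, size_bin, size_tip, BalanceProp, BalanceStar, delta] at *
          omega
      · simp only [balanceL, hd, if_false]
        refine ⟨?_, by simp⟩
        simp only [WeightBalanced, size_bin, BalanceProp, BalanceStar, delta] at *
        simp only [*, and_true, true_and]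
        omega
    · refine ⟨?_, by simp [balanceL]⟩
      simp only [balanceL, WeightBalanced, size_bin, size_tip, BalanceProp, BalanceStar, delta] at *
      simp only [*, and_true]
      omega
  · rcases l with ⟨ls, lx, ll, lr⟩ | _
    · obtain ⟨h1, h2, h3, h4⟩ := hl
      have := nn h3; have := nn h4
      rcases hl0 : ll with ⟨lls, llx, lll, llr⟩ | _ <;>
        rcases hr0 : lr with ⟨lrs, lrx, lrl, lrr⟩ | _ <;> subst hl0 hr0
      · have h3' := h3
        have h4' := h4
        obtain ⟨-, -, h8, h9⟩ := h3'
        obtain ⟨-, -, h10, h11⟩ := h4'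
        have := nn h8; have := nn h9; have := nn h10; have := nn h11
        have hd : lrs < ratio * lls := by
          simp only [WeightBalanced, size_bin, size_tip, BalanceProp, BalanceStar, delta, ratio] at *
          omega
        simp only [balanceL, hd, if_true]
        refine ⟨?_, by simp⟩
        simp only [WeightBalanced, size_bin, size_tip, BalanceProp, BalanceStar, delta] at *
        simp only [*, and_true, true_and]
        omega
      · have h3' := h3
        obtain ⟨-, -, h8, h9⟩ := h3'
        have := nn h8; have := nn h9
        refine ⟨⟨?_, ?_, h3, weightBalanced_singleton x⟩, by simp [balanceL]⟩ <;>
          simp only [WeightBalanced, size_bin, size_tip, BalanceProp, BalanceStar, delta] at * <;>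
          omega
      · have h4' := h4
        obtain ⟨-, -, h8, h9⟩ := h4'
        have := nn h8; have := nn h9
        obtain rfl := h8.eq_tip (by
          simp only [WeightBalanced, size_bin, size_tip, BalanceProp, BalanceStar, delta] at *
          omega)
        obtain rfl := h9.eq_tip (by
          simp only [WeightBalanced, size_bin, size_tip, BalanceProp, BalanceStar, delta] at *
          omega)
        refine ⟨?_, by simp [balanceL]⟩
        simp [balanceL, WeightBalanced, BalanceProp, delta] at *
      · refine ⟨?_, by simp [balanceL]⟩
        simp [balanceL, WeightBalanced, BalanceProp, delta] at *
        omega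
    · exact ⟨weightBalanced_singleton x, rfl⟩

theorem balanceR_spec {x : e} {l r : HSet e} (hl : WeightBalanced l) (hr : WeightBalanced r)
    (h : (BalanceStar (size r - 1) (size l) ∧ 0 < size r) ∨ BalanceProp (size l) (size r) ∨
      BalanceProp (size l + 1) (size r)) :
    WeightBalanced (balanceR x l r) ∧
      toAscList (balanceR x l r) = toAscList l ++ x :: toAscList r := by
  have nn : ∀ {s : HSet e}, WeightBalanced s → 0 ≤ size s := WeightBalanced.size_nonneg
  rcases l with ⟨ls, lx, ll, lr⟩ | _
  · rcases r with ⟨rs, rx, rl, rr⟩ | _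
    · obtain ⟨h1, h2, h3, h4⟩ := hr
      have hl' := hl
      obtain ⟨h5, -, h6, h7⟩ := hl'
      have := nn h3; have := nn h4; have := nn h6; have := nn h7
      by_cases hd : rs > delta * ls
      · rcases hl0 : rl with ⟨rls, rlx, rll, rlr⟩ | _ <;>
          rcases hr0 : rr with ⟨rrs, rrx, rrl, rrr⟩ | _ <;> subst hl0 hr0
        · have h3' := h3
          have h4' := h4
          obtain ⟨-, -, h8, h9⟩ := h3'
          obtain ⟨-, -, h10, h11⟩ := h4'
          have := nn h8; have := nn h9; have := nn h10; have := nn h11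
          simp only [balanceR, hd, if_true]
          split_ifs <;> refine ⟨?_, by simp⟩ <;>
            simp only [WeightBalanced, size_bin, BalanceProp, BalanceStar, delta, ratio] at * <;>
            simp only [*, and_true, true_and] <;> omega
        all_goals
          simp only [WeightBalanced, size_bin, size_tip, BalanceProp, BalanceStar, delta] at *
          omega
      · simp only [balanceR, hd, if_false]
        refine ⟨?_, by simp⟩
        simp only [WeightBalanced, size_bin, BalanceProp, BalanceStar, delta] at *
        simp only [*, and_true, true_and]
        omega
    · refine ⟨?_, by simp [balanceR]⟩
      simp only [balanceR, WeightBalanced, size_bin, size_tip, BalanceProp, BalanceStar, delta] at *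
      simp only [*, and_true]
      omega
  · rcases r with ⟨rs, rx, rl, rr⟩ | _
    · obtain ⟨h1, h2, h3, h4⟩ := hr
      have := nn h3; have := nn h4
      rcases hl0 : rl with ⟨rls, rlx, rll, rlr⟩ | _ <;>
        rcases hr0 : rr with ⟨rrs, rrx, rrl, rrr⟩ | _ <;> subst hl0 hr0
      · have h3' := h3
        have h4' := h4
        obtain ⟨-, -, h8, h9⟩ := h3'
        obtain ⟨-, -, h10, h11⟩ := h4'
        have := nn h8; have := nn h9; have := nn h10; have := nn h11
        have hd : rls < ratio * rrs := by
          simp only [WeightBalanced, size_bin, size_tip, BalanceProp, BalanceStar, delta, ratio] at *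
          omega
        simp only [balanceR, hd, if_true]
        refine ⟨?_, by simp⟩
        simp only [WeightBalanced, size_bin, size_tip, BalanceProp, BalanceStar, delta] at *
        simp only [*, and_true]
        omega
      · have h3' := h3
        obtain ⟨-, -, h8, h9⟩ := h3'
        have := nn h8; have := nn h9
        obtain rfl := h8.eq_tip (by
          simp only [WeightBalanced, size_bin, size_tip, BalanceProp, BalanceStar, delta] at *
          omega)
        obtain rfl := h9.eq_tip (by
          simp only [WeightBalanced, size_bin, size_tip, BalanceProp, BalanceStar, delta] at *
          omega)
        refine ⟨?_, by simp [balanceR]⟩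
        simp [balanceR, WeightBalanced, BalanceProp, delta] at *
      · have h4' := h4
        obtain ⟨-, -, h8, h9⟩ := h4'
        have := nn h8; have := nn h9
        refine ⟨⟨?_, ?_, weightBalanced_singleton x, h4⟩, by simp [balanceR]⟩ <;>
          simp only [WeightBalanced, size_bin, size_tip, BalanceProp, BalanceStar, delta] at * <;>
          omega
      · refine ⟨?_, by simp [balanceR]⟩
        simp [balanceR, WeightBalanced, BalanceProp, delta] at *
        omega
    · exact ⟨weightBalanced_singleton x, rfl⟩

end Structure

section Listing

variable {e : Type*}

/-! ## Trees listing a given list -/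

/-- The tree `s` is weight balanced, and `xs` is the list of its elements from left to right. -/
structure Lists (s : HSet e) (xs : List e) : Prop where
  weightBalanced : WeightBalanced s
  toAscList_eq : toAscList s = xs

theorem WeightBalanced.lists {s : HSet e} (h : WeightBalanced s) : Lists s (toAscList s) := ⟨h, rfl⟩

theorem Lists.size_eq {s : HSet e} {xs : List e} (h : Lists s xs) : size s = (xs.length : ℤ) := by
  rw [h.1.size_eq, h.2]

theorem lists_tip : Lists (tip : HSet e) [] := ⟨trivial, rfl⟩

theorem lists_singleton (x : e) : Lists (singleton x) [x] := ⟨weightBalanced_singleton x, rfl⟩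

theorem Lists.mkBin {x : e} {l r : HSet e} {xs ys : List e} (hl : Lists l xs) (hr : Lists r ys)
    (h : BalanceProp (size l) (size r)) : Lists (mkBin x l r) (xs ++ x :: ys) :=
  ⟨⟨by ring, h, hl.1, hr.1⟩, by simp [HSet.mkBin, hl.2, hr.2]⟩

theorem lookupMinSure_eq (x : e) (l : HSet e) :
    some (lookupMinSure x l) = (toAscList l ++ [x]).head? := by
  induction l generalizing x with
  | tip => rfl
  | bin sz y l r ihl _ => simp [lookupMinSure, ihl, List.head?_append]

theorem lookupMin_eq_head? (s : HSet e) : lookupMin s = (toAscList s).head? := by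
  cases s with
  | tip => rfl
  | bin sz x l r => simp [lookupMin, lookupMinSure_eq, List.head?_append]

theorem lookupMaxSure_eq (x : e) (r : HSet e) :
    some (lookupMaxSure x r) = (x :: toAscList r).getLast? := by
  induction r generalizing x with
  | tip => rfl
  | bin sz y l r _ ihr =>
    simp [lookupMaxSure, ihr, List.getLast?_append, List.getLast?_cons]

theorem lookupMax_eq_getLast? (s : HSet e) : lookupMax s = (toAscList s).getLast? := by
  cases s with
  | tip => rfl
  | bin sz x l r => simp [lookupMax, lookupMaxSure_eq, List.getLast?_append, List.getLast?_cons]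

theorem toAscList_mapMonotonic {e' : Type*} (f : e → e') (s : HSet e) :
    toAscList (mapMonotonic f s) = (toAscList s).map f := by
  induction s with
  | tip => rfl
  | bin sz x l r ihl ihr => simp [mapMonotonic, ihl, ihr]

theorem size_mapMonotonic {e' : Type*} (f : e → e') (s : HSet e) :
    size (mapMonotonic f s) = size s := by
  cases s <;> rfl

theorem WeightBalanced.mapMonotonic {e' : Type*} (f : e → e') {s : HSet e}
    (h : WeightBalanced s) : WeightBalanced (mapMonotonic f s) := by
  induction s with
  | tip => trivial
  | bin sz x l r ihl ihr =>
    obtain ⟨h1, h2, h3, h4⟩ := h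
    exact ⟨by simp only [size_mapMonotonic, h1], by simpa only [size_mapMonotonic] using h2,
      ihl h3, ihr h4⟩

variable [HsPrims e]

theorem Lists.balanceL {x : e} {l r : HSet e} {xs ys : List e} (hl : Lists l xs) (hr : Lists r ys)
    (h : (BalanceStar (size l - 1) (size r) ∧ 0 < size l) ∨ BalanceProp (size l) (size r) ∨
      BalanceProp (size l) (size r + 1)) :
    Lists (balanceL x l r) (xs ++ x :: ys) := by
  obtain ⟨h1, h2⟩ := balanceL_spec (x := x) hl.1 hr.1 h
  exact ⟨h1, by rw [h2, hl.2, hr.2]⟩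

theorem Lists.balanceR {x : e} {l r : HSet e} {xs ys : List e} (hl : Lists l xs) (hr : Lists r ys)
    (h : (BalanceStar (size r - 1) (size l) ∧ 0 < size r) ∨ BalanceProp (size l) (size r) ∨
      BalanceProp (size l + 1) (size r)) :
    Lists (balanceR x l r) (xs ++ x :: ys) := by
  obtain ⟨h1, h2⟩ := balanceR_spec (x := x) hl.1 hr.1 h
  exact ⟨h1, by rw [h2, hl.2, hr.2]⟩

/-! ### Minimum and maximum -/

theorem lists_insertMax (x : e) {s : HSet e} (h : WeightBalanced s) :
    Lists (insertMax x s) (toAscList s ++ [x]) := by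
  induction s with
  | tip => exact lists_singleton x
  | bin sz y l r _ ihr =>
    obtain ⟨-, h2, h3, h4⟩ := h
    have hr := ihr h4
    have hs := hr.size_eq
    have := h4.size_eq
    have := h3.size_nonneg
    simp only [List.length_append, List.length_singleton, Nat.cast_add, Nat.cast_one] at hs
    simpa [insertMax] using h3.lists.balanceR (x := y) hr (by
      simp only [BalanceProp, BalanceStar, delta] at *
      omega)

theorem lists_insertMin (x : e) {s : HSet e} (h : WeightBalanced s) :
    Lists (insertMin x s) (x :: toAscList s) := by
  induction s with
  | tip => exact lists_singleton x
  | bin sz y l r ihl _ =>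
    obtain ⟨-, h2, h3, h4⟩ := h
    have hl := ihl h3
    have hs := hl.size_eq
    have := h3.size_eq
    have := h4.size_nonneg
    simp only [List.length_cons, Nat.cast_add, Nat.cast_one] at hs
    simpa [insertMin] using hl.balanceL (x := y) h4.lists (by
      simp only [BalanceProp, BalanceStar, delta] at *
      omega)

theorem minViewSure_spec (x : e) {l r : HSet e} (hl : WeightBalanced l) (hr : WeightBalanced r)
    (h : BalanceProp (size l) (size r)) :
    WeightBalanced (minViewSure x l r).2 ∧
      toAscList l ++ x :: toAscList r =
        (minViewSure x l r).1 :: toAscList (minViewSure x l r).2 := by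
  induction l generalizing x r with
  | tip => exact ⟨hr, rfl⟩
  | bin ls xl ll lr ihl _ =>
    obtain ⟨h1, h2, h3, h4⟩ := hl
    obtain ⟨h5, h6⟩ := ihl xl h3 h4 h2
    have hs := congrArg List.length h6
    simp only [List.length_append, List.length_cons] at hs
    have := h3.size_eq
    have := h4.size_eq
    have := h5.size_eq
    have := hr.size_nonneg
    have hb := h5.lists.balanceR (x := x) hr.lists (by
      simp only [BalanceProp, BalanceStar, delta, size_bin] at *
      omega)
    refine ⟨hb.1, ?_⟩
    simp only [minViewSure, toAscList_bin, hb.2, h6]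
    rfl

theorem maxViewSure_spec (x : e) {l r : HSet e} (hl : WeightBalanced l) (hr : WeightBalanced r)
    (h : BalanceProp (size l) (size r)) :
    WeightBalanced (maxViewSure x l r).2 ∧
      toAscList l ++ x :: toAscList r =
        toAscList (maxViewSure x l r).2 ++ [(maxViewSure x l r).1] := by
  induction r generalizing x l with
  | tip => cases l <;> exact ⟨hl, rfl⟩
  | bin rs xr rl rr _ ihr =>
    have hd : maxViewSure x l (bin rs xr rl rr) =
        ((maxViewSure xr rl rr).1, HSet.balanceL x l (maxViewSure xr rl rr).2) := by
      cases l <;> rfl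
    obtain ⟨h1, h2, h3, h4⟩ := hr
    obtain ⟨h5, h6⟩ := ihr xr h3 h4 h2
    have hs := congrArg List.length h6
    simp only [List.length_append, List.length_cons, List.length_nil] at hs
    have := h3.size_eq
    have := h4.size_eq
    have := h5.size_eq
    have := hl.size_nonneg
    have hb := hl.lists.balanceL (x := x) h5.lists (by
      simp only [BalanceProp, BalanceStar, delta, size_bin] at *
      omega)
    rw [hd]
    refine ⟨hb.1, ?_⟩
    simp only [toAscList_bin, hb.2, h6]
    simp

theorem lists_deleteMin {s : HSet e} (h : WeightBalanced s) :
    Lists (deleteMin s) (toAscList s).tail := by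
  induction s with
  | tip => exact lists_tip
  | bin sz x l r ihl _ =>
    obtain ⟨-, h2, h3, h4⟩ := h
    cases l with
    | tip => exact h4.lists
    | bin ls lx ll lr =>
      have hl := ihl h3
      have hs := hl.size_eq
      have h0 := h3.size_eq
      have := h4.size_nonneg
      simp only [List.length_tail, toAscList_bin, List.length_append, List.length_cons] at hs h0
      have hb := hl.balanceR (x := x) h4.lists (by
        simp only [BalanceProp, BalanceStar, delta] at *
        omega)
      refine ⟨hb.1, ?_⟩
      rw [deleteMin, hb.2, toAscList_bin _ x, List.tail_append_of_ne_nil (by simp)]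

theorem lists_deleteMax {s : HSet e} (h : WeightBalanced s) :
    Lists (deleteMax s) (toAscList s).dropLast := by
  induction s with
  | tip => exact lists_tip
  | bin sz x l r _ ihr =>
    obtain ⟨-, h2, h3, h4⟩ := h
    cases r with
    | tip => exact ⟨h3, by simp [deleteMax]⟩
    | bin rs rx rl rr =>
      have hr := ihr h4
      have hs := hr.size_eq
      have h0 := h4.size_eq
      have := h3.size_nonneg
      simp only [List.length_dropLast, toAscList_bin, List.length_append, List.length_cons] at hs h0
      have hb := h3.lists.balanceL (x := x) hr (by
        simp only [BalanceProp, BalanceStar, delta] at *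
        omega)
      refine ⟨hb.1, ?_⟩
      rw [deleteMax, hb.2, toAscList_bin _ x, List.dropLast_append_of_ne_nil (by simp),
        List.dropLast_cons_of_ne_nil (by simp)]

/-! ### Joining -/

theorem lists_glue {l r : HSet e} (hl : WeightBalanced l) (hr : WeightBalanced r)
    (h : BalanceProp (size l) (size r)) : Lists (glue l r) (toAscList l ++ toAscList r) := by
  cases l with
  | tip => exact hr.lists
  | bin sl xl ll lr =>
    cases r with
    | tip => exact ⟨hl, by simp [glue]⟩
    | bin sr xr rl rr =>
      have hl' := hl
      have hr' := hr
      obtain ⟨-, h2, h3, h4⟩ := hl'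
      obtain ⟨-, k2, k3, k4⟩ := hr'
      have h1 := hl.size_eq
      have k1 := hr.size_eq
      simp only [glue]
      split_ifs with hc
      · obtain ⟨h5, h6⟩ := maxViewSure_spec xl h3 h4 h2
        have := h5.size_eq
        rw [toAscList_bin, h6] at h1 ⊢
        simpa using h5.lists.balanceR (x := (maxViewSure xl ll lr).1) hr.lists (by
          simp only [BalanceProp, BalanceStar, delta, size_bin, List.length_append,
            List.length_singleton] at *
          omega)
      · obtain ⟨h5, h6⟩ := minViewSure_spec xr k3 k4 k2
        have := h5.size_eq
        rw [toAscList_bin _ xr, h6] at k1 ⊢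
        exact hl.lists.balanceL h5.lists (by
          simp only [BalanceProp, BalanceStar, delta, size_bin, List.length_cons] at *
          omega)

theorem lists_link (x : e) {l r : HSet e} (hl : WeightBalanced l) (hr : WeightBalanced r) :
    Lists (link x l r) (toAscList l ++ x :: toAscList r) := by
  fun_induction link x l r with
  | case1 r => exact lists_insertMin x hr
  | case2 => exact lists_insertMax x hl
  | case3 sl y ly ry sr z lz rz hc ih =>
    have hr' := hr
    obtain ⟨k1, k2, k3, k4⟩ := hr'
    have hj := ih hl k3
    have hs := hj.size_eq
    have := hl.size_eq
    have := k3.size_eq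
    have := k4.size_nonneg
    simp only [List.length_append, List.length_cons] at hs
    simpa using hj.balanceL (x := z) k4.lists (by
      simp only [BalanceProp, BalanceStar, delta, size_bin] at *
      omega)
  | case4 sl y ly ry sr z lz rz hc hc' ih =>
    have hl' := hl
    obtain ⟨k1, k2, k3, k4⟩ := hl'
    have hj := ih k4 hr
    have hs := hj.size_eq
    have := hr.size_eq
    have := k4.size_eq
    have := k3.size_nonneg
    simp only [List.length_append, List.length_cons] at hs
    simpa using k3.lists.balanceR (x := y) hj (by
      simp only [BalanceProp, BalanceStar, delta, size_bin] at *
      omega)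
  | case5 sl y ly ry sr z lz rz hc hc' =>
    exact hl.lists.mkBin hr.lists (by
      simp only [BalanceProp, delta, size_bin] at *
      omega)

theorem lists_merge {l r : HSet e} (hl : WeightBalanced l) (hr : WeightBalanced r) :
    Lists (merge l r) (toAscList l ++ toAscList r) := by
  fun_induction merge l r with
  | case1 r => exact hr.lists
  | case2 => exact ⟨hl, by simp⟩
  | case3 sl y ly ry sr z lz rz hc ih =>
    have hr' := hr
    obtain ⟨k1, k2, k3, k4⟩ := hr'
    have hj := ih hl k3
    have hs := hj.size_eq
    have := hl.size_eq
    have := k3.size_eq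
    have := k4.size_nonneg
    simp only [List.length_append] at hs
    simpa using hj.balanceL (x := z) k4.lists (by
      simp only [BalanceProp, BalanceStar, delta, size_bin] at *
      omega)
  | case4 sl y ly ry sr z lz rz hc hc' ih =>
    have hl' := hl
    obtain ⟨k1, k2, k3, k4⟩ := hl'
    have hj := ih k4 hr
    have hs := hj.size_eq
    have := hr.size_eq
    have := k4.size_eq
    have := k3.size_nonneg
    simp only [List.length_append] at hs
    simpa using k3.lists.balanceR (x := y) hj (by
      simp only [BalanceProp, BalanceStar, delta, size_bin] at *
      omega)
  | case5 sl y ly ry sr z lz rz hc hc' =>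
    exact lists_glue hl hr (by
      simp only [BalanceProp, delta, size_bin] at *
      omega)

theorem Lists.link (x : e) {l r : HSet e} {xs ys : List e} (hl : Lists l xs) (hr : Lists r ys) :
    Lists (link x l r) (xs ++ x :: ys) := by
  simpa [hl.2, hr.2] using lists_link x hl.1 hr.1

theorem Lists.merge {l r : HSet e} {xs ys : List e} (hl : Lists l xs) (hr : Lists r ys) :
    Lists (merge l r) (xs ++ ys) := by
  simpa [hl.2, hr.2] using lists_merge hl.1 hr.1

/-! ### Filtering and mapping -/

theorem lists_filter (p : e → Bool) {s : HSet e} (h : WeightBalanced s) :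
    Lists (filter p s) ((toAscList s).filter p) := by
  induction s with
  | tip => exact lists_tip
  | bin sz x l r ihl ihr =>
    have h' := h
    obtain ⟨-, -, h3, h4⟩ := h'
    have hl := ihl h3
    have hr := ihr h4
    simp only [filter, toAscList_bin, List.filter_append, List.filter_cons]
    split_ifs with hx hp
    · simp only [Bool.and_eq_true] at hp
      refine ⟨h, ?_⟩
      rw [← hl.2, ← hr.2, ← eq_of_ptrEqSet _ _ hp.1, ← eq_of_ptrEqSet _ _ hp.2, toAscList_bin]
    · exact hl.link x hr
    · exact hl.merge hr

theorem lists_partition (p : e → Bool) {s : HSet e} (h : WeightBalanced s) :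
    Lists (partition p s).1 ((toAscList s).filter p) ∧
      Lists (partition p s).2 ((toAscList s).filter fun i => !p i) := by
  induction s with
  | tip => exact ⟨lists_tip, lists_tip⟩
  | bin sz x l r ihl ihr =>
    have h' := h
    obtain ⟨-, -, h3, h4⟩ := h'
    obtain ⟨hl, hl'⟩ := ihl h3
    obtain ⟨hr, hr'⟩ := ihr h4
    simp only [partition, toAscList_bin, List.filter_append, List.filter_cons]
    by_cases hx : p x = true
    · simp only [hx, if_true, Bool.not_true, Bool.false_eq_true, if_false]
      refine ⟨?_, hl'.merge hr'⟩
      split_ifs with hp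
      · simp only [Bool.and_eq_true] at hp
        refine ⟨h, ?_⟩
        rw [← hl.2, ← hr.2, eq_of_ptrEqSet _ _ hp.1, eq_of_ptrEqSet _ _ hp.2, toAscList_bin]
      · exact hl.link x hr
    · simp only [Bool.not_eq_true] at hx
      simp only [hx, if_true, Bool.not_false, Bool.false_eq_true, if_false]
      refine ⟨hl.merge hr, ?_⟩
      split_ifs with hp
      · simp only [Bool.and_eq_true] at hp
        refine ⟨h, ?_⟩
        rw [← hl'.2, ← hr'.2, eq_of_ptrEqSet _ _ hp.1, eq_of_ptrEqSet _ _ hp.2, toAscList_bin]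
      · exact hl'.link x hr'

/-! ### Operations by position -/

theorem lists_takeGo (n : ℤ) {s : HSet e} (h : WeightBalanced s) :
    Lists (takeGo n s) ((toAscList s).take n.toNat) := by
  induction s generalizing n with
  | tip => simpa [takeGo] using lists_tip
  | bin sz x l r ihl ihr =>
    obtain ⟨-, -, h3, h4⟩ := h
    have hs := h3.size_eq
    rw [takeGo, toAscList_bin]
    split_ifs with hn
    · rw [Int.toNat_of_nonpos hn]; exact lists_tip
    · split <;> rename_i hc
      · rw [compare_lt_iff_lt] at hc
        rw [List.take_append_of_le_length (by omega)]
        exact ihl n h3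
      · rw [compare_gt_iff_gt] at hc
        have : n.toNat = (toAscList l).length + ((n - size l - 1).toNat + 1) := by omega
        rw [this, List.take_length_add_append, List.take_succ_cons]
        exact h3.lists.link x (ihr _ h4)
      · rw [compare_eq_iff_eq] at hc
        rw [List.take_append_of_le_length (by omega), List.take_of_length_le (by omega)]
        exact h3.lists

theorem lists_take (n : ℤ) {s : HSet e} (h : WeightBalanced s) :
    Lists (take n s) ((toAscList s).take n.toNat) := by
  have := h.size_eq
  rw [take]
  split_ifs with hn
  · rw [List.take_of_length_le (by omega)]
    exact h.lists
  · exact lists_takeGo n h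

theorem lists_dropGo (n : ℤ) {s : HSet e} (h : WeightBalanced s) :
    Lists (dropGo n s) ((toAscList s).drop n.toNat) := by
  induction s generalizing n with
  | tip => simpa [dropGo] using lists_tip
  | bin sz x l r ihl ihr =>
    have h' := h
    obtain ⟨-, -, h3, h4⟩ := h'
    have hs := h3.size_eq
    rw [dropGo]
    split_ifs with hn
    · rw [Int.toNat_of_nonpos hn]; exact h.lists
    · rw [toAscList_bin]
      split <;> rename_i hc
      · rw [compare_lt_iff_lt] at hc
        rw [List.drop_append_of_le_length (by omega)]
        exact (ihl n h3).link x h4.lists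
      · rw [compare_gt_iff_gt] at hc
        have : n.toNat = (toAscList l).length + ((n - size l - 1).toNat + 1) := by omega
        rw [this, List.drop_length_add_append, List.drop_succ_cons]
        exact ihr _ h4
      · rw [compare_eq_iff_eq] at hc
        rw [List.drop_append_of_le_length (by omega), List.drop_of_length_le (by omega)]
        exact lists_insertMin x h4

theorem lists_drop (n : ℤ) {s : HSet e} (h : WeightBalanced s) :
    Lists (drop n s) ((toAscList s).drop n.toNat) := by
  have := h.size_eq
  rw [drop]
  split_ifs with hn
  · rw [List.drop_of_length_le (by omega)]
    exact lists_tip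
  · exact lists_dropGo n h

theorem splitAtGo_eq (n : ℤ) (s : HSet e) : splitAtGo n s = (takeGo n s, dropGo n s) := by
  induction s generalizing n with
  | tip => simp [splitAtGo, takeGo, dropGo]
  | bin sz x l r ihl ihr =>
    rw [splitAtGo, takeGo, dropGo]
    split_ifs with hn
    · rfl
    · split <;> simp [ihl, ihr]

theorem splitAt_eq (n : ℤ) (s : HSet e) : splitAt n s = (take n s, drop n s) := by
  simp only [splitAt, take, drop, splitAtGo_eq]
  split_ifs <;> rfl

/-! ### Conversion from lists -/

theorem two_pow_succ_ne_one (k : ℕ) : (2 : ℤ) ^ (k + 1) ≠ 1 := by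
  have : (0 : ℤ) < 2 ^ k := by positivity
  rw [pow_succ]
  omega

theorem two_pow_succ_shiftRight (k : ℕ) : (2 : ℤ) ^ (k + 1) >>> (1 : ℕ) = 2 ^ k := by
  rw [Int.shiftRight_eq_div_pow, pow_succ]
  simp

theorem two_pow_shiftLeft (k : ℕ) : (2 : ℤ) ^ k <<< (1 : ℕ) = 2 ^ (k + 1) := by
  rw [Int.shiftLeft_eq, ← pow_add]

theorem createAsc_spec (k : ℕ) (xs : List e) : ∃ t ys ws, Lists t ws ∧ ws ++ ys = xs ∧
    ∀ n, k < n → createAsc n (2 ^ k) xs = some (t, ys) := by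
  induction k generalizing xs with
  | zero =>
    rcases xs with _ | ⟨x, xs⟩
    · exact ⟨tip, [], [], lists_tip, rfl, fun n hn => by
        obtain ⟨n, rfl⟩ := Nat.exists_eq_add_of_le' hn; rfl⟩
    · exact ⟨singleton x, xs, [x], lists_singleton x, rfl, fun n hn => by
        obtain ⟨n, rfl⟩ := Nat.exists_eq_add_of_le' hn; simp [createAsc, singleton]⟩
  | succ k ih =>
    rcases xs with _ | ⟨x, xs⟩
    · exact ⟨tip, [], [], lists_tip, rfl, fun n hn => by
        obtain ⟨n, rfl⟩ := Nat.exists_eq_add_of_le' hn; rfl⟩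
    · obtain ⟨l, _ | ⟨y, ys⟩, ws, hl, hx, hn⟩ := ih (x :: xs)
      · refine ⟨l, [], ws, hl, hx, fun n hk => ?_⟩
        obtain ⟨n, rfl⟩ := Nat.exists_eq_add_one_of_ne_zero (Nat.ne_zero_of_lt hk)
        rw [createAsc, if_neg (two_pow_succ_ne_one k), two_pow_succ_shiftRight, hn n (by omega)]
      · obtain ⟨r, zs, us, hr, hy, hm⟩ := ih ys
        refine ⟨link y l r, zs, ws ++ y :: us, hl.link y hr, by simp [← hx, ← hy],
          fun n hk => ?_⟩
        obtain ⟨n, rfl⟩ := Nat.exists_eq_add_one_of_ne_zero (Nat.ne_zero_of_lt hk)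
        rw [createAsc, if_neg (two_pow_succ_ne_one k), two_pow_succ_shiftRight, hn n (by omega)]
        simp only [hm n (by omega)]

theorem goAsc_spec (k : ℕ) {l : HSet e} {ws : List e} (hl : Lists l ws) (xs : List e) :
    ∃ t, Returns (fun n => goAsc n (2 ^ k) l xs) t ∧ Lists t (ws ++ xs) := by
  induction hm : xs.length using Nat.strong_induction_on generalizing k l ws xs with
  | _ m ih =>
    rcases xs with _ | ⟨x, xs⟩
    · refine ⟨l, ⟨1, fun n hn => ?_⟩, by simpa using hl⟩
      obtain ⟨n, rfl⟩ := Nat.exists_eq_add_of_le' hn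
      rfl
    · obtain ⟨r, ys, us, hr, hx, hc⟩ := createAsc_spec k xs
      have hlen := congrArg List.length hx
      simp only [List.length_append, List.length_cons] at hlen hm
      obtain ⟨t, ⟨N, hN⟩, ht⟩ := ih ys.length (by omega) (k + 1) (hl.link x hr) ys rfl
      refine ⟨t, ⟨max N (k + 1) + 1, fun n hn => ?_⟩, by simpa [← hx] using ht⟩
      obtain ⟨n, rfl⟩ := Nat.exists_eq_add_one_of_ne_zero (Nat.ne_zero_of_lt hn)
      simp only [goAsc, hc n (by omega), two_pow_shiftLeft]
      exact hN n (by omega)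

theorem fromDistinctAscList_spec (xs : List e) :
    ∃ t, Returns (fun n => fromDistinctAscList n xs) t ∧ Lists t xs := by
  rcases xs with _ | ⟨x, xs⟩
  · exact ⟨tip, ⟨0, fun _ _ => rfl⟩, lists_tip⟩
  · exact goAsc_spec 0 (lists_singleton x) xs

theorem createDesc_spec (k : ℕ) (xs : List e) : ∃ t ys ws, Lists t ws ∧ ws.reverse ++ ys = xs ∧
    ∀ n, k < n → createDesc n (2 ^ k) xs = some (t, ys) := by
  induction k generalizing xs with
  | zero =>
    rcases xs with _ | ⟨x, xs⟩
    · exact ⟨tip, [], [], lists_tip, rfl, fun n hn => by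
        obtain ⟨n, rfl⟩ := Nat.exists_eq_add_of_le' hn; rfl⟩
    · exact ⟨singleton x, xs, [x], lists_singleton x, rfl, fun n hn => by
        obtain ⟨n, rfl⟩ := Nat.exists_eq_add_of_le' hn; simp [createDesc, singleton]⟩
  | succ k ih =>
    rcases xs with _ | ⟨x, xs⟩
    · exact ⟨tip, [], [], lists_tip, rfl, fun n hn => by
        obtain ⟨n, rfl⟩ := Nat.exists_eq_add_of_le' hn; rfl⟩
    · obtain ⟨r, _ | ⟨y, ys⟩, ws, hr, hx, hn⟩ := ih (x :: xs)
      · refine ⟨r, [], ws, hr, hx, fun n hk => ?_⟩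
        obtain ⟨n, rfl⟩ := Nat.exists_eq_add_one_of_ne_zero (Nat.ne_zero_of_lt hk)
        rw [createDesc, if_neg (two_pow_succ_ne_one k), two_pow_succ_shiftRight, hn n (by omega)]
      · obtain ⟨l, zs, us, hl, hy, hm⟩ := ih ys
        refine ⟨link y l r, zs, us ++ y :: ws, hl.link y hr, by simp [← hx, ← hy],
          fun n hk => ?_⟩
        obtain ⟨n, rfl⟩ := Nat.exists_eq_add_one_of_ne_zero (Nat.ne_zero_of_lt hk)
        rw [createDesc, if_neg (two_pow_succ_ne_one k), two_pow_succ_shiftRight, hn n (by omega)]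
        simp only [hm n (by omega)]

theorem goDesc_spec (k : ℕ) {r : HSet e} {ws : List e} (hr : Lists r ws) (xs : List e) :
    ∃ t, Returns (fun n => goDesc n (2 ^ k) r xs) t ∧ Lists t (xs.reverse ++ ws) := by
  induction hm : xs.length using Nat.strong_induction_on generalizing k r ws xs with
  | _ m ih =>
    rcases xs with _ | ⟨x, xs⟩
    · refine ⟨r, ⟨1, fun n hn => ?_⟩, by simpa using hr⟩
      obtain ⟨n, rfl⟩ := Nat.exists_eq_add_of_le' hn
      rfl
    · obtain ⟨l, ys, us, hl, hx, hc⟩ := createDesc_spec k xs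
      have hlen := congrArg List.length hx
      simp only [List.length_append, List.length_cons] at hlen hm
      obtain ⟨t, ⟨N, hN⟩, ht⟩ := ih ys.length (by omega) (k + 1) (hl.link x hr) ys rfl
      refine ⟨t, ⟨max N (k + 1) + 1, fun n hn => ?_⟩, by simpa [← hx] using ht⟩
      obtain ⟨n, rfl⟩ := Nat.exists_eq_add_one_of_ne_zero (Nat.ne_zero_of_lt hn)
      simp only [goDesc, hc n (by omega), two_pow_shiftLeft]
      exact hN n (by omega)

theorem fromDistinctDescList_spec (xs : List e) :
    ∃ t, Returns (fun n => fromDistinctDescList n xs) t ∧ Lists t xs.reverse := by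
  rcases xs with _ | ⟨x, xs⟩
  · exact ⟨tip, ⟨0, fun _ _ => rfl⟩, lists_tip⟩
  · rw [List.reverse_cons]
    exact goDesc_spec 0 (lists_singleton x) xs

end Listing

section Keys

/-! ## The linear order of equivalence classes -/

variable {e : Type*} [BEq e] [EquivBEq e]

/-- The setoid of elements up to `==`. -/
def keySetoid (e : Type*) [BEq e] [EquivBEq e] : Setoid e where
  r a b := (a == b) = true
  iseqv := ⟨fun _ => BEq.rfl, fun h => BEq.symm h, fun h k => BEq.trans h k⟩

/-- Elements up to `==`. -/
def Key (e : Type*) [BEq e] [EquivBEq e] : Type _ := Quotient (keySetoid e)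

/-- The equivalence class of an element. -/
def key (x : e) : Key e := Quotient.mk (keySetoid e) x

theorem key_surjective : Function.Surjective (key : e → Key e) := Quotient.exists_rep

theorem beq_iff {a b : e} : (a == b) = true ↔ key a = key b :=
  ⟨fun h => Quotient.sound h, fun h => Quotient.exact (s := keySetoid e) h⟩

theorem elem_iff {xs : List e} {i : e} : xs.elem i = true ↔ key i ∈ xs.map key := by
  induction xs with
  | nil => simp
  | cons x xs ih =>
    rw [List.map_cons, List.mem_cons, ← ih, ← beq_iff]
    cases h : i == x <;> simp [List.elem, h]

/-- The keys of the elements of a tree, from left to right. -/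
def keys (s : HSet e) : List (Key e) := (toAscList s).map key

@[simp] theorem keys_tip : keys (tip : HSet e) = [] := rfl

@[simp] theorem keys_bin (sz : ℤ) (x : e) (l r : HSet e) :
    keys (bin sz x l r) = keys l ++ key x :: keys r := by simp [keys]

theorem sem_iff {s : HSet e} {i : e} : sem s i = true ↔ key i ∈ keys s := by
  induction s with
  | tip => simp [sem]
  | bin sz x l r ihl ihr => simp [sem, ihl, ihr, beq_iff, or_assoc]

variable [HsOrd e] [OrdLaws e]

theorem le_of_beq {a b : e} (h : (a == b) = true) : HsOrd.le a b = true := by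
  by_contra hn
  rw [Bool.not_eq_true] at hn
  have h1 := (OrdLaws.compare_gt a b).2 hn
  rw [(OrdLaws.compare_eq a b).2 h] at h1
  cases h1

theorem le_congr {a b a' b' : e} (ha : (a == a') = true) (hb : (b == b') = true) :
    HsOrd.le a b = HsOrd.le a' b' := by
  rw [Bool.eq_iff_iff]
  exact ⟨fun h => OrdLaws.trans_le _ _ _ (le_of_beq (BEq.symm ha))
      (OrdLaws.trans_le _ _ _ h (le_of_beq hb)),
    fun h => OrdLaws.trans_le _ _ _ (le_of_beq ha)
      (OrdLaws.trans_le _ _ _ h (le_of_beq (BEq.symm hb)))⟩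

noncomputable instance : LinearOrder (Key e) where
  le := Quotient.lift₂ (fun a b => HsOrd.le a b = true)
    fun _ _ _ _ h k => congrArg (· = true) (le_congr h k)
  le_refl := by
    intro a
    obtain ⟨a, rfl⟩ := key_surjective a
    exact le_of_beq BEq.rfl
  le_trans := by
    intro a b c
    obtain ⟨a, rfl⟩ := key_surjective a
    obtain ⟨b, rfl⟩ := key_surjective b
    obtain ⟨c, rfl⟩ := key_surjective c
    exact OrdLaws.trans_le a b c
  le_antisymm := by
    intro a b
    obtain ⟨a, rfl⟩ := key_surjective a
    obtain ⟨b, rfl⟩ := key_surjective b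
    exact fun h k => beq_iff.1 (OrdLaws.antisymm a b h k)
  le_total := by
    intro a b
    obtain ⟨a, rfl⟩ := key_surjective a
    obtain ⟨b, rfl⟩ := key_surjective b
    exact OrdLaws.total a b
  toDecidableLE := Classical.decRel _

theorem le_iff {a b : e} : HsOrd.le a b = true ↔ key a ≤ key b := Iff.rfl

theorem le_eq_false_iff {a b : e} : HsOrd.le a b = false ↔ key b < key a := by
  rw [← not_le, ← le_iff, Bool.not_eq_true]

theorem ge_iff {a b : e} : HsOrd.ge a b = true ↔ key b ≤ key a := by
  rw [OrdLaws.ge_le, le_iff]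

theorem lt_iff {a b : e} : HsOrd.lt a b = true ↔ key a < key b := by
  rw [OrdLaws.lt_le, Bool.not_eq_true', le_eq_false_iff]

theorem gt_iff {a b : e} : HsOrd.gt a b = true ↔ key b < key a := by
  rw [OrdLaws.gt_le, Bool.not_eq_true', le_eq_false_iff]

theorem compare_lt_iff {a b : e} : HsOrd.compare a b = .lt ↔ key a < key b := by
  rw [OrdLaws.compare_lt, le_eq_false_iff]

theorem compare_gt_iff {a b : e} : HsOrd.compare a b = .gt ↔ key b < key a := by
  rw [OrdLaws.compare_gt, le_eq_false_iff]

theorem compare_eq_iff {a b : e} : HsOrd.compare a b = .eq ↔ key a = key b := by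
  rw [OrdLaws.compare_eq, beq_iff]

theorem isLB_iff {lb : Option e} {x : e} :
    isLB lb x = true ↔ ∀ b, lb = some b → key b < key x := by
  cases lb <;> simp [isLB, lt_iff]

theorem isUB_iff {ub : Option e} {x : e} :
    isUB ub x = true ↔ ∀ b, ub = some b → key x < key b := by
  cases ub <;> simp [isUB, lt_iff]

/-! ## Trees denoting a set of keys -/

/-- The key `k` lies strictly between the bounds. -/
def InBounds (lb ub : Option e) (k : Key e) : Prop :=
  (∀ b, lb = some b → key b < k) ∧ ∀ b, ub = some b → k < key b

/-- The tree `s` is weight balanced and ordered, and its keys are those satisfying `P`. -/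
structure Denotes (s : HSet e) (P : Key e → Prop) : Prop where
  weightBalanced : WeightBalanced s
  sorted : (keys s).Pairwise (· < ·)
  mem_iff : ∀ k, k ∈ keys s ↔ P k

theorem Denotes.congr {s : HSet e} {P Q : Key e → Prop} (h : Denotes s P) (hPQ : ∀ k, P k ↔ Q k) :
    Denotes s Q :=
  ⟨h.1, h.2, fun k => (h.3 k).trans (hPQ k)⟩

theorem Denotes.self {s : HSet e} {P : Key e → Prop} (h : Denotes s P) :
    Denotes s (· ∈ keys s) := ⟨h.1, h.2, fun _ => Iff.rfl⟩

theorem Denotes.lists {s : HSet e} {P : Key e → Prop} (h : Denotes s P) : Lists s (toAscList s) :=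
  h.1.lists

theorem denotes_tip {P : Key e → Prop} (h : ∀ k, ¬P k) : Denotes (tip : HSet e) P :=
  ⟨trivial, by simp, by simpa using h⟩

theorem Denotes.of_tip {P : Key e → Prop} (h : Denotes (tip : HSet e) P) (k : Key e) : ¬P k := by
  simpa using (h.3 k).symm

theorem Lists.denotes_join {t l r : HSet e} {x : e} {P : Key e → Prop}
    (ht : Lists t (toAscList l ++ x :: toAscList r)) (hl : Denotes l fun k => P k ∧ k < key x)
    (hr : Denotes r fun k => P k ∧ key x < k) (hx : P (key x)) : Denotes t P := by
  have hk : keys t = keys l ++ key x :: keys r := by simp [keys, ht.2]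
  refine ⟨ht.1, ?_, fun k => ?_⟩
  · rw [hk, List.pairwise_append, List.pairwise_cons]
    refine ⟨hl.2, ⟨fun k h => ((hr.3 k).1 h).2, hr.2⟩, fun a ha b hb => ?_⟩
    have h1 := ((hl.3 a).1 ha).2
    rcases List.mem_cons.1 hb with rfl | hb
    · exact h1
    · exact h1.trans ((hr.3 b).1 hb).2
  · rw [hk, List.mem_append, List.mem_cons, hl.3, hr.3]
    grind

theorem Lists.denotes_append {t l r : HSet e} {x : e} {P : Key e → Prop}
    (ht : Lists t (toAscList l ++ toAscList r)) (hl : Denotes l fun k => P k ∧ k < key x)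
    (hr : Denotes r fun k => P k ∧ key x < k) (hx : ¬P (key x)) : Denotes t P := by
  have hk : keys t = keys l ++ keys r := by simp [keys, ht.2]
  refine ⟨ht.1, ?_, fun k => ?_⟩
  · rw [hk, List.pairwise_append]
    exact ⟨hl.2, hr.2, fun a ha b hb => ((hl.3 a).1 ha).2.trans ((hr.3 b).1 hb).2⟩
  · rw [hk, List.mem_append, hl.3, hr.3]
    grind

theorem Denotes.of_bin {sz : ℤ} {x : e} {l r : HSet e} {P : Key e → Prop}
    (h : Denotes (bin sz x l r) P) :
    (Denotes l fun k => P k ∧ k < key x) ∧ (Denotes r fun k => P k ∧ key x < k) ∧ P (key x) ∧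
      sz = 1 + size l + size r ∧ BalanceProp (size l) (size r) := by
  obtain ⟨⟨h1, h2, h3, h4⟩, hs, hm⟩ := h
  simp only [keys_bin, List.pairwise_append, List.pairwise_cons, List.mem_append,
    List.mem_cons] at hs hm
  obtain ⟨h5, ⟨h6, h7⟩, h8⟩ := hs
  refine ⟨⟨h3, h5, fun k => ?_⟩, ⟨h4, h7, fun k => ?_⟩, ?_, h1, h2⟩
  · rw [← hm]
    exact ⟨fun h => ⟨.inl h, h8 _ h _ (.inl rfl)⟩, fun ⟨h, hk⟩ => by
      rcases h with h | rfl | h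
      · exact h
      · exact absurd hk (lt_irrefl _)
      · exact absurd (hk.trans (h6 _ h)) (lt_irrefl _)⟩
  · rw [← hm]
    exact ⟨fun h => ⟨.inr (.inr h), h6 _ h⟩, fun ⟨h, hk⟩ => by
      rcases h with h | rfl | h
      · exact absurd (hk.trans (h8 _ h _ (.inl rfl))) (lt_irrefl _)
      · exact absurd hk (lt_irrefl _)
      · exact h⟩
  · exact (hm _).1 (.inr (.inl rfl))

theorem bounded_iff {s : HSet e} {lb ub : Option e} :
    Bounded s lb ub ↔ Denotes s (· ∈ keys s) ∧ ∀ k ∈ keys s, InBounds lb ub k := by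
  constructor
  · intro h
    induction h with
    | tip lb ub => exact ⟨denotes_tip (by simp), by simp⟩
    | bin lb ub l r x sz _ _ hlx hux hsz hbal ihl ihr =>
      obtain ⟨hl, hlb⟩ := ihl
      obtain ⟨hr, hrb⟩ := ihr
      rw [isLB_iff] at hlx
      rw [isUB_iff] at hux
      simp only [InBounds, Option.some.injEq, forall_eq'] at *
      constructor
      · have hL : Lists (HSet.bin sz x l r) (toAscList l ++ x :: toAscList r) :=
          ⟨⟨hsz, hbal, hl.1, hr.1⟩, by simp⟩
        refine hL.denotes_join (hl.congr ?_) (hr.congr ?_) ?_ <;>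
          simp only [keys_bin, List.mem_append, List.mem_cons] <;> grind
      · simp only [keys_bin, List.mem_append, List.mem_cons]
        grind
  · rintro ⟨h, hb⟩
    induction s generalizing lb ub with
    | tip => exact .tip _ _
    | bin sz x l r ihl ihr =>
      obtain ⟨hl, hr, hx, hsz, hbal⟩ := h.of_bin
      refine .bin _ _ _ _ _ _ (ihl hl.self fun k hk => ?_) (ihr hr.self fun k hk => ?_)
        (isLB_iff.2 (hb _ hx).1) (isUB_iff.2 (hb _ hx).2) hsz hbal
      · rw [hl.3] at hk
        exact ⟨(hb k hk.1).1, by simpa using hk.2⟩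
      · rw [hr.3] at hk
        exact ⟨by simpa using hk.2, (hb k hk.1).2⟩

theorem Bounded.denotes {s : HSet e} {lb ub : Option e} (h : Bounded s lb ub) :
    Denotes s (· ∈ keys s) := (bounded_iff.1 h).1

theorem Bounded.inBounds {s : HSet e} {lb ub : Option e} (h : Bounded s lb ub) :
    ∀ k ∈ keys s, InBounds lb ub k := (bounded_iff.1 h).2

theorem Denotes.bounded {s : HSet e} {P : Key e → Prop} {lb ub : Option e} (h : Denotes s P)
    (hb : ∀ k, P k → InBounds lb ub k) : Bounded s lb ub :=
  bounded_iff.2 ⟨h.self, fun k hk => hb k ((h.3 k).1 hk)⟩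

theorem Denotes.desc {s : HSet e} {P : Key e → Prop} {lb ub : Option e} {sz : ℤ} {f : e → Bool}
    (h : Denotes s P) (hb : ∀ k, P k → InBounds lb ub k) (hsz : size s = sz)
    (hf : ∀ i, f i = true ↔ P (key i)) : Desc s lb ub sz f :=
  ⟨h.bounded hb, hsz, fun i => by rw [Bool.eq_iff_iff, sem_iff, h.3, hf]⟩

theorem inBounds_key_iff {lb ub : Option e} {x : e} :
    InBounds lb ub (key x) ↔ isLB lb x = true ∧ isUB ub x = true := by
  rw [isLB_iff, isUB_iff]; rfl

/-! ### Sizes -/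

theorem Denotes.nodup {s : HSet e} {P : Key e → Prop} (h : Denotes s P) : (keys s).Nodup :=
  h.2.imp ne_of_lt

theorem Denotes.size_eq_length_keys {s : HSet e} {P : Key e → Prop} (h : Denotes s P) :
    size s = ((keys s).length : ℤ) := by
  rw [h.1.size_eq, keys, List.length_map]

theorem Denotes.size_eq_length {s : HSet e} {P : Key e → Prop} (h : Denotes s P)
    {xs : List (Key e)} (hn : xs.Nodup) (hm : ∀ k, k ∈ xs ↔ P k) :
    size s = (xs.length : ℤ) := by
  rw [h.size_eq_length_keys, ((List.perm_ext_iff_of_nodup h.nodup hn).2 fun k => by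
    rw [h.3, hm]).length_eq]

theorem Denotes.size_le_of_imp {s t : HSet e} {P Q : Key e → Prop} (hs : Denotes s P)
    (ht : Denotes t Q) (h : ∀ k, P k → Q k) : size s ≤ size t := by
  rw [hs.size_eq_length_keys, ht.size_eq_length_keys]
  exact_mod_cast (List.subperm_of_subset hs.nodup fun k hk =>
    (ht.3 k).2 (h k ((hs.3 k).1 hk))).length_le

theorem Denotes.imp_of_size_le {s t : HSet e} {P Q : Key e → Prop} (hs : Denotes s P)
    (ht : Denotes t Q) (h : ∀ k, P k → Q k) (hsz : size t ≤ size s) (k : Key e) (hk : Q k) :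
    P k := by
  rw [hs.size_eq_length_keys, ht.size_eq_length_keys] at hsz
  have hp := (List.subperm_of_subset hs.nodup fun k hk =>
    (ht.3 k).2 (h k ((hs.3 k).1 hk))).perm_of_length_le (by exact_mod_cast hsz)
  rw [← hs.3, hp.mem_iff, ht.3]
  exact hk

theorem Denotes.size_of_insert {s t : HSet e} {P : Key e → Prop} {a : Key e} [Decidable (P a)]
    (hs : Denotes s P) (ht : Denotes t fun k => k = a ∨ P k) :
    size t = if P a then size s else 1 + size s := by
  split_ifs with ha
  · rw [ht.size_eq_length hs.nodup fun k => by rw [hs.3]; grind, hs.size_eq_length_keys]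
  · rw [ht.size_eq_length (xs := a :: keys s) (List.nodup_cons.2 ⟨by rwa [hs.3], hs.nodup⟩)
      fun k => by rw [List.mem_cons, hs.3], hs.size_eq_length_keys, List.length_cons]
    push_cast
    ring

theorem Denotes.size_of_erase {s t : HSet e} {P : Key e → Prop} {a : Key e} [Decidable (P a)]
    (hs : Denotes s P) (ht : Denotes t fun k => k ≠ a ∧ P k) :
    size t = if P a then size s - 1 else size s := by
  classical
  split_ifs with ha
  · have := ht.size_of_insert (t := s) (a := a) (hs.congr fun k => by grind)
    rw [if_neg (by simp)] at this
    omega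
  · rw [ht.size_eq_length hs.nodup fun k => by rw [hs.3]; grind, hs.size_eq_length_keys]

theorem Denotes.size_eq_countP {s t : HSet e} {P R : Key e → Prop} {p : e → Bool}
    (hs : Denotes s P) (ht : Denotes t fun k => P k ∧ R k)
    (hp : ∀ i, p i = true ↔ R (key i)) : size t = ((toAscList s).countP p : ℤ) := by
  have hn := hs.nodup
  rw [List.countP_eq_length_filter, ← List.length_map (f := key)]
  refine ht.size_eq_length (hn.sublist (List.filter_sublist.map key)) fun k => ?_
  rw [← hs.3, keys]
  simp only [List.mem_map, List.mem_filter, hp]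
  grind

theorem Denotes.size_eq_distinctCount {s : HSet e} {P : Key e → Prop} {xs : List e}
    (hs : Denotes s P) (hm : ∀ k, k ∈ xs.map key ↔ P k) : size s = distinctCount xs := by
  rw [distinctCount, ← List.length_map (f := key)]
  have hne : ∀ a b : e, (a == b) = false ↔ key a ≠ key b := fun a b => by
    rw [Ne, ← beq_iff, Bool.not_eq_true]
  refine hs.size_eq_length ?_ fun k => ?_
  · rw [List.Nodup, List.pairwise_map]
    exact (List.pairwise_pwFilter (R := fun a b => (a == b) = false) xs).imp fun h => (hne _ _).1 h
  · rw [← hm]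
    refine ⟨fun h => List.map_subset key (List.pwFilter_subset xs) h, fun h => ?_⟩
    by_contra hk
    obtain ⟨i, hi, rfl⟩ := List.mem_map.1 h
    have h1 := (List.forall_mem_pwFilter (R := fun a b : e => (a == b) = false) (by
      intro x y z hxz
      simp only [hne] at *
      by_contra! hc
      exact hxz (hc.1.trans hc.2)) i xs).1 (fun b hb => by
        rw [hne]
        exact fun hib => hk (hib ▸ List.mem_map_of_mem hb)) i hi
    exact (hne _ _).1 h1 rfl

end Keys

section Operations

theorem splitS_eq {e : Type*} [HsOrd e] [HsPrims e] (x : e) (s : HSet e) :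
    splitS x s = ((splitMember x s).1, (splitMember x s).2.2) := by
  induction s with
  | tip => rfl
  | bin sz y l r ihl ihr =>
    simp only [splitS, splitMember]
    split <;> simp [ihl, ihr]
variable {e : Type*} [BEq e] [EquivBEq e] [HsOrd e] [OrdLaws e]

/-! ## Operations that compare elements -/

theorem Denotes.member_iff {s : HSet e} {P : Key e → Prop} (h : Denotes s P) (x : e) :
    member x s = true ↔ P (key x) := by
  induction s generalizing P with
  | tip => simpa [member] using h.of_tip _
  | bin sz y l r ihl ihr =>
    obtain ⟨hl, hr, hy, -⟩ := h.of_bin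
    simp only [member]
    split <;> rename_i hc
    · rw [compare_lt_iff] at hc
      rw [ihl hl]
      exact and_iff_left hc
    · rw [compare_gt_iff] at hc
      rw [ihr hr]
      exact and_iff_left hc
    · rw [compare_eq_iff] at hc
      simpa [hc] using hy

variable [HsPrims e]

theorem Denotes.insert_spec {s : HSet e} {P : Key e → Prop} (h : Denotes s P) (x : e) :
    Denotes (insert x s) fun k => k = key x ∨ P k := by
  classical
  induction s generalizing P with
  | tip =>
    have := h.of_tip
    exact (lists_singleton x).denotes_join (l := tip) (r := tip) (denotes_tip (by grind))
      (denotes_tip (by grind)) (.inl rfl)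
  | bin sz y l r ihl ihr =>
    obtain ⟨hl, hr, hy, hsz, hbal⟩ := h.of_bin
    simp only [insert]
    split <;> rename_i hc
    · rw [compare_lt_iff] at hc
      have h1 := ihl hl
      split_ifs with hp
      · rw [eq_of_ptrEqSet _ _ hp] at h1
        exact h.congr fun k => by have := (h1.3 k).symm.trans (hl.3 k); grind
      · have hs := hl.size_of_insert h1
        have := hl.1.size_nonneg
        have := hr.1.size_nonneg
        refine (h1.lists.balanceL (x := y) hr.lists ?_).denotes_join (h1.congr (by grind))
          (hr.congr (by grind)) (.inr hy)
        simp only [BalanceProp, BalanceStar, delta] at *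
        split_ifs at hs <;> omega
    · rw [compare_gt_iff] at hc
      have h1 := ihr hr
      split_ifs with hp
      · rw [eq_of_ptrEqSet _ _ hp] at h1
        exact h.congr fun k => by have := (h1.3 k).symm.trans (hr.3 k); grind
      · have hs := hr.size_of_insert h1
        have := hl.1.size_nonneg
        have := hr.1.size_nonneg
        refine (hl.lists.balanceR (x := y) h1.lists ?_).denotes_join (hl.congr (by grind))
          (h1.congr (by grind)) (.inr hy)
        simp only [BalanceProp, BalanceStar, delta] at *
        split_ifs at hs <;> omega
    · rw [compare_eq_iff] at hc
      split_ifs with hp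
      · exact h.congr (by grind)
      · have hL : Lists (bin sz x l r) (toAscList l ++ x :: toAscList r) :=
          ⟨⟨hsz, hbal, hl.1, hr.1⟩, by simp⟩
        exact hL.denotes_join (hl.congr (by grind)) (hr.congr (by grind)) (.inl rfl)

theorem Denotes.insertR_spec {s : HSet e} {P : Key e → Prop} (h : Denotes s P) (x : e) :
    Denotes (insertR x s) fun k => k = key x ∨ P k := by
  classical
  induction s generalizing P with
  | tip => exact h.insert_spec x
  | bin sz y l r ihl ihr =>
    obtain ⟨hl, hr, hy, hsz, hbal⟩ := h.of_bin
    simp only [insertR]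
    split <;> rename_i hc
    · rw [compare_lt_iff] at hc
      have h1 := ihl hl
      split_ifs with hp
      · rw [eq_of_ptrEqSet _ _ hp] at h1
        exact h.congr fun k => by have := (h1.3 k).symm.trans (hl.3 k); grind
      · have hs := hl.size_of_insert h1
        have := hl.1.size_nonneg
        have := hr.1.size_nonneg
        refine (h1.lists.balanceL (x := y) hr.lists ?_).denotes_join (h1.congr (by grind))
          (hr.congr (by grind)) (.inr hy)
        simp only [BalanceProp, BalanceStar, delta] at *
        split_ifs at hs <;> omega
    · rw [compare_gt_iff] at hc
      have h1 := ihr hr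
      split_ifs with hp
      · rw [eq_of_ptrEqSet _ _ hp] at h1
        exact h.congr fun k => by have := (h1.3 k).symm.trans (hr.3 k); grind
      · have hs := hr.size_of_insert h1
        have := hl.1.size_nonneg
        have := hr.1.size_nonneg
        refine (hl.lists.balanceR (x := y) h1.lists ?_).denotes_join (hl.congr (by grind))
          (h1.congr (by grind)) (.inr hy)
        simp only [BalanceProp, BalanceStar, delta] at *
        split_ifs at hs <;> omega
    · rw [compare_eq_iff] at hc
      exact h.congr (by grind)

theorem Denotes.delete_spec {s : HSet e} {P : Key e → Prop} (h : Denotes s P) (x : e) :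
    Denotes (delete x s) fun k => k ≠ key x ∧ P k := by
  classical
  induction s generalizing P with
  | tip =>
    have := h.of_tip
    exact denotes_tip (by grind)
  | bin sz y l r ihl ihr =>
    obtain ⟨hl, hr, hy, hsz, hbal⟩ := h.of_bin
    simp only [delete]
    split <;> rename_i hc
    · rw [compare_lt_iff] at hc
      have h1 := ihl hl
      split_ifs with hp
      · rw [eq_of_ptrEqSet _ _ hp] at h1
        exact h.congr fun k => by have := (h1.3 k).symm.trans (hl.3 k); grind
      · have hs := hl.size_of_erase h1
        have := h1.1.size_nonneg
        have := hr.1.size_nonneg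
        refine (h1.lists.balanceR (x := y) hr.lists ?_).denotes_join (h1.congr (by grind))
          (hr.congr (by grind)) (by grind)
        simp only [BalanceProp, BalanceStar, delta] at *
        split_ifs at hs <;> omega
    · rw [compare_gt_iff] at hc
      have h1 := ihr hr
      split_ifs with hp
      · rw [eq_of_ptrEqSet _ _ hp] at h1
        exact h.congr fun k => by have := (h1.3 k).symm.trans (hr.3 k); grind
      · have hs := hr.size_of_erase h1
        have := hl.1.size_nonneg
        have := h1.1.size_nonneg
        refine (hl.lists.balanceL (x := y) h1.lists ?_).denotes_join (hl.congr (by grind))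
          (h1.congr (by grind)) (by grind)
        simp only [BalanceProp, BalanceStar, delta] at *
        split_ifs at hs <;> omega
    · rw [compare_eq_iff] at hc
      exact (lists_glue hl.1 hr.1 hbal).denotes_append (x := y) (hl.congr (by grind))
        (hr.congr (by grind)) (by grind)

theorem Denotes.link {l r : HSet e} {x : e} {P : Key e → Prop}
    (hl : Denotes l fun k => P k ∧ k < key x) (hr : Denotes r fun k => P k ∧ key x < k)
    (hx : P (key x)) : Denotes (link x l r) P :=
  (lists_link x hl.1 hr.1).denotes_join hl hr hx

theorem Denotes.merge {l r : HSet e} {x : e} {P : Key e → Prop}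
    (hl : Denotes l fun k => P k ∧ k < key x) (hr : Denotes r fun k => P k ∧ key x < k)
    (hx : ¬P (key x)) : Denotes (merge l r) P :=
  (lists_merge hl.1 hr.1).denotes_append hl hr hx

theorem Denotes.splitMember_spec {s : HSet e} {P : Key e → Prop} (h : Denotes s P) (x : e) :
    (Denotes (splitMember x s).1 fun k => P k ∧ k < key x) ∧
      ((splitMember x s).2.1 = true ↔ P (key x)) ∧
      Denotes (splitMember x s).2.2 fun k => P k ∧ key x < k := by
  induction s generalizing P with
  | tip =>
    have := h.of_tip
    exact ⟨denotes_tip (by grind), by simp [splitMember, this], denotes_tip (by grind)⟩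
  | bin sz y l r ihl ihr =>
    obtain ⟨hl, hr, hy, -, -⟩ := h.of_bin
    simp only [splitMember]
    split <;> rename_i hc
    · rw [compare_lt_iff] at hc
      obtain ⟨h1, h2, h3⟩ := ihl hl
      exact ⟨h1.congr (by grind), h2.trans (by grind),
        (h3.congr (by grind)).link (hr.congr (by grind)) ⟨hy, hc⟩⟩
    · rw [compare_gt_iff] at hc
      obtain ⟨h1, h2, h3⟩ := ihr hr
      exact ⟨(hl.congr (by grind)).link (h1.congr (by grind)) ⟨hy, hc⟩, h2.trans (by grind),
        h3.congr (by grind)⟩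
    · rw [compare_eq_iff] at hc
      rw [hc]
      exact ⟨hl, by simpa using hy, hr⟩

theorem Denotes.splitS_spec {s : HSet e} {P : Key e → Prop} (h : Denotes s P) (x : e) :
    (Denotes (splitS x s).1 fun k => P k ∧ k < key x) ∧
      Denotes (splitS x s).2 fun k => P k ∧ key x < k := by
  rw [splitS_eq]
  exact ⟨(h.splitMember_spec x).1, (h.splitMember_spec x).2.2⟩

end Operations

section SetOperations

variable {e : Type*} [BEq e] [EquivBEq e] [HsOrd e] [OrdLaws e]

/-! ### Set operations -/

theorem Denotes.bin_tip_tip_iff {sz : ℤ} {x : e} {P : Key e → Prop}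
    (h : Denotes (bin sz x tip tip) P) (k : Key e) : P k ↔ k = key x := by
  rw [← h.3]
  simp

variable [HsPrims e]

theorem Denotes.union_spec {s t : HSet e} {P Q : Key e → Prop} (hs : Denotes s P)
    (ht : Denotes t Q) : Denotes (union s t) fun k => P k ∨ Q k := by
  induction s generalizing t P Q with
  | tip =>
    rw [union.eq_def]
    split
    · exact hs.congr fun k => by simp [ht.of_tip]
    · exact (hs.insertR_spec _).congr fun k => by rw [ht.bin_tip_tip_iff]; exact or_comm
    · contradiction
    · exact ht.congr fun k => by simp [hs.of_tip]
    · contradiction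
  | bin sz x l r ihl ihr =>
    rw [union.eq_def]
    split
    · exact hs.congr fun k => by simp [ht.of_tip]
    · exact (hs.insertR_spec _).congr fun k => by rw [ht.bin_tip_tip_iff]; exact or_comm
    · rename_i heq _ _
      rw [heq] at hs
      exact (ht.insert_spec _).congr fun k => by rw [hs.bin_tip_tip_iff]
    · contradiction
    · rename_i heq _ _
      cases heq
      obtain ⟨hl, hr, hx, -, -⟩ := hs.of_bin
      obtain ⟨h1, h2⟩ := ht.splitS_spec x
      have h3 := ihl hl h1
      have h4 := ihr hr h2
      clear ihl ihr
      dsimp only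
      split_ifs with hp
      · rw [Bool.and_eq_true] at hp
        rw [eq_of_ptrEqSet _ _ hp.1] at h3
        rw [eq_of_ptrEqSet _ _ hp.2] at h4
        have hL : Lists (bin sz x l r) (toAscList l ++ x :: toAscList r) := ⟨hs.1, by simp⟩
        exact hL.denotes_join (h3.congr (by grind)) (h4.congr (by grind)) (.inl hx)
      · exact (h3.congr (by grind)).link (h4.congr (by grind)) (.inl hx)

theorem Denotes.foldl_union {ss : List (HSet e)} {t : HSet e} {Q : Key e → Prop}
    (ht : Denotes t Q) (hs : ∀ s ∈ ss, Denotes s (· ∈ keys s)) :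
    Denotes (ss.foldl union t) fun k => Q k ∨ ∃ s ∈ ss, k ∈ keys s := by
  induction ss generalizing t Q with
  | nil => exact ht.congr (by simp)
  | cons s ss ih =>
    refine (ih (ht.union_spec (hs s (by simp))) fun s' hs' => hs s' (by simp [hs'])).congr ?_
    simp [or_assoc]

theorem Denotes.difference_spec {s t : HSet e} {P Q : Key e → Prop} (hs : Denotes s P)
    (ht : Denotes t Q) : Denotes (difference s t) fun k => P k ∧ ¬Q k := by
  induction t generalizing s P Q with
  | tip =>
    have hQ := ht.of_tip
    have : difference s tip = s := by cases s <;> simp only [difference]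
    rw [this]
    exact hs.congr fun k => by simp [hQ]
  | bin sz x l r ihl ihr =>
    obtain ⟨hl, hr, hx, -, -⟩ := ht.of_bin
    have h1 : Denotes (split x s).1 fun k => P k ∧ k < key x := (hs.splitS_spec x).1
    have h2 : Denotes (split x s).2 fun k => P k ∧ key x < k := (hs.splitS_spec x).2
    rcases s with ⟨_, y, sl, sr⟩ | _
    · simp only [difference]
      have h3 := ihl h1 hl
      have h4 := ihr h2 hr
      clear ihl ihr
      have h5 : Denotes (HSet.merge _ _) fun k => P k ∧ ¬Q k :=
        Denotes.merge (x := x) (h3.congr (by grind)) (h4.congr (by grind)) (by grind)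
      split_ifs with hsz
      · have h6 := (lists_merge h3.1 h4.1).size_eq
        rw [List.length_append, Nat.cast_add, ← h3.1.size_eq, ← h4.1.size_eq, hsz] at h6
        have := h5.imp_of_size_le hs (fun k hk => hk.1) h6.ge
        exact hs.congr fun k => ⟨this k, fun h => h.1⟩
      · exact h5
    · rw [difference]
      exact hs.congr fun k => by simp [hs.of_tip]

theorem Denotes.intersection_spec {s t : HSet e} {P Q : Key e → Prop} (hs : Denotes s P)
    (ht : Denotes t Q) : Denotes (intersection s t) fun k => P k ∧ Q k := by
  induction s generalizing t P Q with
  | tip =>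
    rw [intersection]
    exact hs.congr fun k => by simp [hs.of_tip]
  | bin sz x l r ihl ihr =>
    obtain ⟨hl, hr, hx, -, -⟩ := hs.of_bin
    obtain ⟨h1, hb, h2⟩ := ht.splitMember_spec x
    rcases t with ⟨_, y, sl, sr⟩ | _
    · simp only [intersection]
      have h3 := ihl hl h1
      have h4 := ihr hr h2
      clear ihl ihr
      split_ifs with hm hp
      · rw [hb] at hm
        rw [Bool.and_eq_true] at hp
        rw [eq_of_ptrEqSet _ _ hp.1] at h3
        rw [eq_of_ptrEqSet _ _ hp.2] at h4
        have hL : Lists (bin sz x l r) (toAscList l ++ x :: toAscList r) := ⟨hs.1, by simp⟩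
        exact hL.denotes_join (h3.congr (by grind)) (h4.congr (by grind)) ⟨hx, hm⟩
      · rw [hb] at hm
        exact (h3.congr (by grind)).link (h4.congr (by grind)) ⟨hx, hm⟩
      · rw [hb] at hm
        exact Denotes.merge (x := x) (h3.congr (by grind)) (h4.congr (by grind)) (by grind)
    · simp only [intersection]
      exact ht.congr fun k => by simp [ht.of_tip]

theorem Denotes.disjoint_iff {s t : HSet e} {P Q : Key e → Prop} (hs : Denotes s P)
    (ht : Denotes t Q) : disjoint s t = true ↔ ∀ k, ¬(P k ∧ Q k) := by
  induction s generalizing t P Q with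
  | tip =>
    have hP := hs.of_tip
    cases t <;> simp [disjoint, hP]
  | bin sz x l r ihl ihr =>
    obtain ⟨hl, hr, hx, -, -⟩ := hs.of_bin
    obtain ⟨h1, hb, h2⟩ := ht.splitMember_spec x
    rcases t with ⟨_, y, sl, sr⟩ | _
    · simp only [disjoint, Bool.and_eq_true, Bool.not_eq_true', ← Bool.not_eq_true, hb, ihl hl h1,
        ihr hr h2]
      constructor
      · rintro ⟨⟨h3, h4⟩, h5⟩ k ⟨hk, hk'⟩
        rcases lt_trichotomy k (key x) with h | rfl | h
        · exact h4 k ⟨⟨hk, h⟩, hk', h⟩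
        · exact h3 hk'
        · exact h5 k ⟨⟨hk, h⟩, hk', h⟩
      · exact fun h => ⟨⟨fun h' => h _ ⟨hx, h'⟩, fun k hk => h k ⟨hk.1.1, hk.2.1⟩⟩,
          fun k hk => h k ⟨hk.1.1, hk.2.1⟩⟩
    · simp [disjoint, ht.of_tip]

theorem Denotes.isSubsetOfX_iff {s t : HSet e} {P Q : Key e → Prop} (hs : Denotes s P)
    (ht : Denotes t Q) : isSubsetOfX s t = true ↔ ∀ k, P k → Q k := by
  induction s generalizing t P Q with
  | tip =>
    have hP := hs.of_tip
    cases t <;> simp [isSubsetOfX, hP]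
  | bin sz x l r ihl ihr =>
    obtain ⟨hl, hr, hx, -, -⟩ := hs.of_bin
    obtain ⟨h1, hb, h2⟩ := ht.splitMember_spec x
    rcases t with ⟨_, y, sl, sr⟩ | _
    · simp only [isSubsetOfX, Bool.and_eq_true, hb, ihl hl h1, ihr hr h2]
      constructor
      · rintro ⟨⟨h3, h4⟩, h5⟩ k hk
        rcases lt_trichotomy k (key x) with h | rfl | h
        · exact (h4 k ⟨hk, h⟩).1
        · exact h3
        · exact (h5 k ⟨hk, h⟩).1
      · exact fun h => ⟨⟨h _ hx, fun k hk => ⟨h k hk.1, hk.2⟩⟩, fun k hk => ⟨h k hk.1, hk.2⟩⟩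
    · have hQ := ht.of_tip
      simp only [isSubsetOfX, Bool.false_eq_true, false_iff]
      exact fun h => hQ _ (h _ hx)

theorem Denotes.isSubsetOf_iff {s t : HSet e} {P Q : Key e → Prop} (hs : Denotes s P)
    (ht : Denotes t Q) : isSubsetOf s t = true ↔ ∀ k, P k → Q k := by
  rw [isSubsetOf, Bool.and_eq_true, decide_eq_true_eq, hs.isSubsetOfX_iff ht]
  exact and_iff_right_of_imp fun h => hs.size_le_of_imp ht h

end SetOperations

section Unordered

variable {e : Type*} [BEq e] [EquivBEq e]

theorem elem_toAscList (s : HSet e) (i : e) : (toAscList s).elem i = sem s i := by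
  rw [Bool.eq_iff_iff, elem_iff, sem_iff, keys]

theorem not_beq_and_sem_iff {s : HSet e} {i m : e} :
    (!(i == m) && sem s i) = true ↔ key i ≠ key m ∧ key i ∈ keys s := by
  rw [Bool.and_eq_true, Bool.not_eq_true', ← Bool.not_eq_true, beq_iff, sem_iff]

theorem toAscList_eq_nil_iff {s : HSet e} : toAscList s = [] ↔ ∀ i, sem s i = false := by
  simp only [← Bool.not_eq_true, sem_iff]
  constructor
  · simp +contextual [keys]
  · intro h
    by_contra hne
    obtain ⟨x, hx⟩ := List.exists_mem_of_ne_nil _ hne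
    exact h x (List.mem_map_of_mem hx)

theorem eq_tip_iff {s : HSet e} : s = tip ↔ ∀ i, sem s i = false := by
  rw [← toAscList_eq_nil_iff]
  cases s <;> simp

/-! ### Adjacent equal elements -/

theorem combineEqGo_sublist {e : Type*} [BEq e] (z : e) (ys : List e) : (combineEqGo z ys).Sublist (z :: ys) := by
  induction ys generalizing z with
  | nil => simp [combineEqGo]
  | cons y ys ih =>
    rw [combineEqGo]
    split_ifs
    · exact (ih z).trans ((List.sublist_cons_self y ys).cons_cons z)
    · exact (ih y).cons_cons z

theorem combineEq_sublist {e : Type*} [BEq e] (xs : List e) : (combineEq xs).Sublist xs := by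
  cases xs with
  | nil => exact List.Sublist.refl _
  | cons x xs => exact combineEqGo_sublist x xs

theorem mem_map_key_combineEqGo (k : Key e) (z : e) (ys : List e) :
    k ∈ (combineEqGo z ys).map key ↔ k ∈ (z :: ys).map key := by
  induction ys generalizing z with
  | nil => simp [combineEqGo]
  | cons y ys ih =>
    rw [combineEqGo]
    split_ifs with h
    · rw [ih]
      simp [← beq_iff.1 h]
    · rw [List.map_cons, List.mem_cons, ih]
      simp

theorem mem_map_key_combineEq (k : Key e) (xs : List e) :
    k ∈ (combineEq xs).map key ↔ k ∈ xs.map key := by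
  cases xs with
  | nil => rfl
  | cons x xs => exact mem_map_key_combineEqGo k x xs

theorem pairwise_combineEqGo {r : Key e → Key e → Prop} [Std.Antisymm r] {z : e} {ys : List e}
    (h : (z :: ys).Pairwise fun a b => r (key a) (key b)) :
    (combineEqGo z ys).Pairwise fun a b => r (key a) (key b) ∧ key a ≠ key b := by
  induction ys generalizing z with
  | nil => simp [combineEqGo]
  | cons y ys ih =>
    rw [combineEqGo]
    split_ifs with hzy
    · exact ih (h.sublist ((List.sublist_cons_self y ys).cons_cons z))
    · rw [beq_iff] at hzy
      obtain ⟨hz, hy⟩ := List.pairwise_cons.1 h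
      refine List.pairwise_cons.2 ⟨fun b hb => ?_, ih hy⟩
      have hb' := (combineEqGo_sublist y ys).subset hb
      refine ⟨hz b hb', fun heq => hzy ?_⟩
      rcases List.mem_cons.1 hb' with rfl | hb'
      · exact heq
      · refine Std.Antisymm.antisymm (r := r) _ _ (hz y (by simp)) ?_
        rw [heq]
        exact (List.pairwise_cons.1 hy).1 b hb'

theorem pairwise_combineEq {r : Key e → Key e → Prop} [Std.Antisymm r] {xs : List e}
    (h : xs.Pairwise fun a b => r (key a) (key b)) :
    (combineEq xs).Pairwise fun a b => r (key a) (key b) ∧ key a ≠ key b := by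
  cases xs with
  | nil => exact .nil
  | cons x xs => exact pairwise_combineEqGo h

end Unordered

section Lists

variable {e : Type*} [BEq e] [EquivBEq e] [HsOrd e] [OrdLaws e]

/-! ## Validity -/

theorem realsize_eq_some_iff {e : Type*} {s : HSet e} {n : ℤ} :
    realsize s = some n ↔ realsize s = some (size s) ∧ n = size s := by
  cases s with
  | tip => simp [realsize, eq_comm]
  | bin sz x l r =>
    rw [realsize]
    split
    · split_ifs <;> simp [eq_comm]
    · simp

theorem bounded_iff_check {s : HSet e} {lb ub : Option e} :
    Bounded s lb ub ↔
      balanced s = true ∧ orderedGo (isLB lb) (isUB ub) s = true ∧ realsize s = some (size s) := by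
  induction s generalizing lb ub with
  | tip => exact ⟨fun _ => ⟨rfl, rfl, rfl⟩, fun _ => .tip _ _⟩
  | bin sz x l r ihl ihr =>
    have hgt : (fun y => HsOrd.gt y x) = isLB (some x) := by
      funext y
      rw [isLB, Bool.eq_iff_iff, gt_iff, lt_iff]
    have hsize : realsize (bin sz x l r) = some (size (bin sz x l r)) ↔
        realsize l = some (size l) ∧ realsize r = some (size r) ∧ sz = 1 + size l + size r := by
      rw [realsize, size_bin]
      split
      · rename_i n m hn hm
        rw [realsize_eq_some_iff] at hn hm
        rw [hn.1, hm.1, hn.2, hm.2]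
        split_ifs with h
        · simp only [true_and, true_iff]
          omega
        · simp only [true_and, false_iff]
          omega
      · rename_i hne
        simp only [reduceCtorEq, false_iff]
        exact fun h => hne _ _ h.1 h.2.1
    rw [hsize, orderedGo, hgt, balanced]
    simp only [Bool.and_eq_true, Bool.or_eq_true, decide_eq_true_eq]
    constructor
    · rintro (_ | ⟨_, _, _, _, _, _, hl, hr, hlx, hux, hsz, hbal⟩)
      obtain ⟨h1, h2, h3⟩ := ihl.1 hl
      obtain ⟨h4, h5, h6⟩ := ihr.1 hr
      exact ⟨⟨⟨hbal, h1⟩, h4⟩, ⟨⟨⟨hlx, hux⟩, h2⟩, h5⟩, h3, h6, hsz⟩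
    · rintro ⟨⟨⟨hbal, h1⟩, h4⟩, ⟨⟨⟨hlx, hux⟩, h2⟩, h5⟩, h3, h6, hsz⟩
      exact .bin _ _ _ _ _ _ (ihl.2 ⟨h1, h2, h3⟩) (ihr.2 ⟨h4, h5, h6⟩) hlx hux hsz hbal

theorem wf_iff_valid (s : HSet e) : WF s ↔ valid s = true := by
  rw [WF, bounded_iff_check, valid, ordered, validsize]
  simp only [Bool.and_eq_true, decide_eq_true_eq, and_assoc]
  rfl

/-! ## Trees described by lists -/

theorem pairwise_lt_iff {xs : List e} :
    xs.Pairwise (fun a b => HsOrd.lt a b = true) ↔ (xs.map key).Pairwise (· < ·) := by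
  simp only [lt_iff, List.pairwise_map]

theorem Bounded.pairwise {s : HSet e} {lb ub : Option e} (h : Bounded s lb ub) :
    (toAscList s).Pairwise (fun a b => HsOrd.lt a b = true) :=
  pairwise_lt_iff.2 h.denotes.2

theorem Bounded.bounds {s : HSet e} {lb ub : Option e} (h : Bounded s lb ub) :
    ∀ x ∈ toAscList s, isLB lb x = true ∧ isUB ub x = true := fun _ hx =>
  inBounds_key_iff.1 (h.inBounds _ (List.mem_map_of_mem hx))

theorem Lists.denotes {t : HSet e} {xs : List e} (ht : Lists t xs)
    (hs : xs.Pairwise (fun a b => HsOrd.lt a b = true)) : Denotes t (· ∈ xs.map key) :=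
  ⟨ht.1, by rw [keys, ht.2]; exact pairwise_lt_iff.1 hs, fun k => by rw [keys, ht.2]⟩

theorem Lists.desc {t : HSet e} {xs : List e} {lb ub : Option e} (ht : Lists t xs)
    (hs : xs.Pairwise (fun a b => HsOrd.lt a b = true))
    (hb : ∀ x ∈ xs, isLB lb x = true ∧ isUB ub x = true) :
    Desc t lb ub (xs.length : ℤ) (fun i => xs.elem i) := by
  refine (ht.denotes hs).desc (fun k hk => ?_) ht.size_eq fun i => elem_iff
  obtain ⟨x, hx, rfl⟩ := List.mem_map.1 hk
  exact inBounds_key_iff.2 (hb x hx)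

theorem Bounded.desc_of_sublist {s t : HSet e} {xs : List e} {lb ub : Option e}
    (h : Bounded s lb ub) (ht : Lists t xs) (hx : xs.Sublist (toAscList s)) :
    Desc t lb ub (xs.length : ℤ) (fun i => xs.elem i) :=
  ht.desc (h.pairwise.sublist hx) fun x hm => h.bounds x (hx.subset hm)

theorem Bounded.denotes_of_cons {s t : HSet e} {m : e} {lb ub : Option e} (h : Bounded s lb ub)
    (ht : WeightBalanced t) (hL : toAscList s = m :: toAscList t) :
    (Denotes t fun k => k ≠ key m ∧ k ∈ keys s) ∧ (∀ k ∈ keys t, key m < k) ∧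
      size t = size s - 1 := by
  have hs := h.denotes.2
  have hk : keys s = key m :: keys t := by rw [keys, hL]; rfl
  rw [hk, List.pairwise_cons] at hs
  refine ⟨⟨ht, hs.2, fun k => ?_⟩, hs.1, ?_⟩
  · rw [hk, List.mem_cons]
    exact ⟨fun h => ⟨(hs.1 k h).ne', .inr h⟩, fun h => h.2.resolve_left h.1⟩
  · rw [ht.size_eq, h.denotes.1.size_eq, hL]
    simp

theorem Bounded.denotes_of_concat {s t : HSet e} {m : e} {lb ub : Option e} (h : Bounded s lb ub)
    (ht : WeightBalanced t) (hL : toAscList s = toAscList t ++ [m]) :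
    (Denotes t fun k => k ≠ key m ∧ k ∈ keys s) ∧ (∀ k ∈ keys t, k < key m) ∧
      size t = size s - 1 := by
  have hs := h.denotes.2
  have hk : keys s = keys t ++ [key m] := by rw [keys, hL]; simp [keys]
  rw [hk, List.pairwise_append] at hs
  have hlt : ∀ k ∈ keys t, k < key m := fun k hk => hs.2.2 k hk _ (by simp)
  refine ⟨⟨ht, hs.1, fun k => ?_⟩, hlt, ?_⟩
  · rw [hk, List.mem_append, List.mem_singleton]
    exact ⟨fun h => ⟨(hlt k h).ne, .inl h⟩, fun h => h.2.resolve_right h.1⟩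
  · rw [ht.size_eq, h.denotes.1.size_eq, hL]
    simp

theorem Bounded.desc_delete_of_cons {s t : HSet e} {m : e} {lb ub : Option e}
    (h : Bounded s lb ub) (ht : WeightBalanced t) (hL : toAscList s = m :: toAscList t) :
    Desc t lb ub (size s - 1) (fun i => !(i == m) && sem s i) :=
  (h.denotes_of_cons ht hL).1.desc (fun k hk => h.inBounds k hk.2) (h.denotes_of_cons ht hL).2.2
    fun _ => not_beq_and_sem_iff

theorem Bounded.desc_delete_of_concat {s t : HSet e} {m : e} {lb ub : Option e}
    (h : Bounded s lb ub) (ht : WeightBalanced t) (hL : toAscList s = toAscList t ++ [m]) :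
    Desc t lb ub (size s - 1) (fun i => !(i == m) && sem s i) :=
  (h.denotes_of_concat ht hL).1.desc (fun k hk => h.inBounds k hk.2)
    (h.denotes_of_concat ht hL).2.2 fun _ => not_beq_and_sem_iff

theorem Bounded.view_of_cons {s t : HSet e} {m : e} {lb ub : Option e}
    (h : Bounded s lb ub) (ht : WeightBalanced t) (hL : toAscList s = m :: toAscList t) :
    sem s m = true ∧ isLB lb m = true ∧ isUB ub m = true ∧
      Desc t (some m) ub (size s - 1) (fun i => !(i == m) && sem s i) := by
  obtain ⟨hd, hlt, hsz⟩ := h.denotes_of_cons ht hL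
  have hb := h.bounds m (by simp [hL])
  refine ⟨by simp [sem_iff, keys, hL], hb.1, hb.2,
    hd.desc (fun k hk => ⟨?_, (h.inBounds k hk.2).2⟩) hsz fun _ => not_beq_and_sem_iff⟩
  simpa using hlt k ((hd.3 k).2 hk)

theorem Bounded.view_of_concat {s t : HSet e} {m : e} {lb ub : Option e}
    (h : Bounded s lb ub) (ht : WeightBalanced t) (hL : toAscList s = toAscList t ++ [m]) :
    sem s m = true ∧ isLB lb m = true ∧ isUB ub m = true ∧
      Desc t lb (some m) (size s - 1) (fun i => !(i == m) && sem s i) := by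
  obtain ⟨hd, hlt, hsz⟩ := h.denotes_of_concat ht hL
  have hb := h.bounds m (by simp [hL])
  refine ⟨by simp [sem_iff, keys, hL], hb.1, hb.2,
    hd.desc (fun k hk => ⟨(h.inBounds k hk.2).1, ?_⟩) hsz fun _ => not_beq_and_sem_iff⟩
  simpa using hlt k ((hd.3 k).2 hk)

/-! ### Separated trees -/

theorem desc_of_join {t l r : HSet e} {x : e} {lb ub : Option e}
    (ht : Lists t (toAscList l ++ x :: toAscList r)) (hl : Bounded l lb (some x))
    (hr : Bounded r (some x) ub) (hlx : isLB lb x = true) (hux : isUB ub x = true) :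
    Desc t lb ub (1 + size l + size r) (fun i => sem l i || i == x || sem r i) := by
  have h1 := hl.inBounds
  have h2 := hr.inBounds
  have hx := inBounds_key_iff.2 ⟨hlx, hux⟩
  simp only [InBounds, Option.some.injEq, forall_eq'] at h1 h2 hx
  have hd : Denotes t fun k => k ∈ keys l ∨ k = key x ∨ k ∈ keys r :=
    ht.denotes_join (hl.denotes.congr (by grind)) (hr.denotes.congr (by grind)) (by grind)
  refine hd.desc (fun k hk => ?_) ?_ fun i => ?_
  · rw [InBounds]
    grind
  · rw [ht.size_eq, hl.denotes.1.size_eq, hr.denotes.1.size_eq, List.length_append,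
      List.length_cons]
    push_cast
    ring
  · rw [Bool.or_eq_true, Bool.or_eq_true, sem_iff, sem_iff, beq_iff, or_assoc]

theorem desc_of_append {t l r : HSet e} {x : e} {lb ub : Option e}
    (ht : Lists t (toAscList l ++ toAscList r)) (hl : Bounded l lb (some x))
    (hr : Bounded r (some x) ub) (hlx : isLB lb x = true) (hux : isUB ub x = true) :
    Desc t lb ub (size l + size r) (fun i => sem l i || sem r i) := by
  have h1 := hl.inBounds
  have h2 := hr.inBounds
  have hx := inBounds_key_iff.2 ⟨hlx, hux⟩
  simp only [InBounds, Option.some.injEq, forall_eq'] at h1 h2 hx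
  have hd : Denotes t fun k => k ∈ keys l ∨ k ∈ keys r :=
    ht.denotes_append (x := x) (hl.denotes.congr (by grind)) (hr.denotes.congr (by grind)) (by grind)
  refine hd.desc (fun k hk => ?_) ?_ fun i => ?_
  · rw [InBounds]
    grind
  · rw [ht.size_eq, hl.denotes.1.size_eq, hr.denotes.1.size_eq, List.length_append]
    push_cast
    ring
  · rw [Bool.or_eq_true, sem_iff, sem_iff]

theorem pairwise_lt_combineEq {xs : List e} (h : xs.Pairwise fun a b => HsOrd.le a b = true) :
    (combineEq xs).Pairwise fun a b => HsOrd.lt a b = true :=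
  (pairwise_combineEq (r := (· ≤ ·)) h).imp fun h => lt_iff.2 (lt_of_le_of_ne h.1 h.2)

theorem pairwise_gt_combineEq {xs : List e} (h : xs.Pairwise fun a b => HsOrd.ge a b = true) :
    (combineEq xs).Pairwise fun a b => HsOrd.gt a b = true :=
  (pairwise_combineEq (r := (· ≥ ·)) (h.imp ge_iff.1)).imp fun h =>
    gt_iff.2 (lt_of_le_of_ne h.1 h.2.symm)

theorem Lists.desc_distinctCount {t : HSet e} {xs ys : List e} {lb ub : Option e}
    (ht : Lists t ys) (hs : ys.Pairwise (fun a b => HsOrd.lt a b = true))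
    (hm : ∀ k, k ∈ ys.map key ↔ k ∈ xs.map key)
    (hb : ∀ x ∈ xs, isLB lb x = true ∧ isUB ub x = true) :
    Desc t lb ub (distinctCount xs) (fun i => xs.elem i) := by
  have hd := (ht.denotes hs).congr hm
  refine hd.desc (fun k hk => ?_) (hd.size_eq_distinctCount fun k => Iff.rfl) fun i => elem_iff
  obtain ⟨x, hx, rfl⟩ := List.mem_map.1 hk
  exact inBounds_key_iff.2 (hb x hx)

theorem pairwise_gt_reverse {xs : List e} :
    xs.reverse.Pairwise (fun a b => HsOrd.lt a b = true) ↔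
      xs.Pairwise fun a b => HsOrd.gt a b = true := by
  simp only [List.pairwise_reverse, lt_iff, gt_iff]

end Lists

/-! ## Descriptions of the operations -/

section Descriptions

variable {e : Type*}

theorem lookupMin_eq_some {s : HSet e} {m : e} (h : lookupMin s = some m) :
    toAscList s = m :: (toAscList s).tail := by
  rw [lookupMin_eq_head?] at h
  obtain ⟨xs, hxs⟩ := List.head?_eq_some_iff.1 h
  rw [hxs, List.tail_cons]

theorem lookupMax_eq_some {s : HSet e} {m : e} (h : lookupMax s = some m) :
    toAscList s = (toAscList s).dropLast ++ [m] := by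
  rw [lookupMax_eq_getLast?] at h
  obtain ⟨xs, hxs⟩ := List.getLast?_eq_some_iff.1 h
  rw [hxs, List.dropLast_concat]

theorem lookupMin_eq_none {s : HSet e} (h : lookupMin s = none) : s = tip := by
  cases s with
  | tip => rfl
  | bin => cases h

theorem lookupMax_eq_none {s : HSet e} (h : lookupMax s = none) : s = tip := by
  cases s with
  | tip => rfl
  | bin => cases h

theorem respects_not {e : Type*} [BEq e] {p : e → Bool} (hp : Respects p) :
    Respects fun i => !p i :=
  fun x y h => congrArg (!·) (hp x y h)

theorem desc_tip {e : Type*} [BEq e] [HsOrd e] (lb ub : Option e) :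
    Desc tip lb ub 0 (fun _ => false) :=
  ⟨.tip _ _, rfl, fun _ => rfl⟩

theorem forall_sem_iff {e : Type*} [BEq e] [EquivBEq e] {s t : HSet e} :
    (∀ k, k ∈ keys s → k ∈ keys t) ↔ ∀ i, sem s i = true → sem t i = true := by
  simp only [sem_iff]
  exact ⟨fun h i => h _, fun h k => by
    obtain ⟨i, rfl⟩ := key_surjective k
    exact h i⟩

variable [BEq e] [EquivBEq e] [HsOrd e] [OrdLaws e]

theorem Bounded.size_eq {s : HSet e} {lb ub : Option e} (h : Bounded s lb ub) :
    size s = ((toAscList s).length : ℤ) := h.denotes.1.size_eq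

theorem subtrees_of_bounded_bin {sz : ℤ} {x : e} {l r : HSet e} {lb ub : Option e}
    (h : Bounded (bin sz x l r) lb ub) :
    WeightBalanced l ∧ WeightBalanced r ∧ BalanceProp (size l) (size r) ∧
      size l + size r = sz - 1 := by
  obtain ⟨hl, hr, -, hsz, hbal⟩ := h.denotes.of_bin
  exact ⟨hl.1, hr.1, hbal, by omega⟩

theorem member_eq_sem {s : HSet e} {lb ub : Option e} (h : Bounded s lb ub) (x : e) :
    member x s = sem s x := by
  rw [Bool.eq_iff_iff, h.denotes.member_iff, sem_iff]

theorem lookupMin_spec {s : HSet e} (h : WF s) :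
    (lookupMin s = none ↔ ∀ i, sem s i = false) ∧
      ∀ m, lookupMin s = some m →
        sem s m = true ∧ ∀ i, sem s i = true → HsOrd.le m i = true := by
  rw [lookupMin_eq_head?, List.head?_eq_none_iff, toAscList_eq_nil_iff]
  refine ⟨Iff.rfl, fun m hm => ?_⟩
  obtain ⟨xs, hxs⟩ := List.head?_eq_some_iff.1 hm
  have hs := h.denotes.2
  rw [keys, hxs, List.map_cons, List.pairwise_cons] at hs
  simp only [sem_iff, keys, hxs, le_iff, List.map_cons, List.mem_cons, true_or, true_and]
  rintro i (hi | hi)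
  · exact hi.ge
  · exact (hs.1 _ hi).le

theorem lookupMax_spec {s : HSet e} (h : WF s) :
    (lookupMax s = none ↔ ∀ i, sem s i = false) ∧
      ∀ m, lookupMax s = some m →
        sem s m = true ∧ ∀ i, sem s i = true → HsOrd.le i m = true := by
  rw [lookupMax_eq_getLast?, List.getLast?_eq_none_iff, toAscList_eq_nil_iff]
  refine ⟨Iff.rfl, fun m hm => ?_⟩
  obtain ⟨xs, hxs⟩ := List.getLast?_eq_some_iff.1 hm
  have hs := h.denotes.2
  rw [keys, hxs, List.map_append, List.pairwise_append] at hs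
  simp only [sem_iff, keys, hxs, le_iff, List.map_append, List.mem_append, List.map_cons,
    List.map_nil, List.mem_singleton, or_true, true_and]
  rintro i (hi | hi)
  · exact (hs.2.2 _ hi _ (by simp)).le
  · exact hi.le

theorem toDescList_spec {s : HSet e} (h : WF s) :
    toDescList s = (toAscList s).reverse ∧
      (toDescList s).Pairwise (fun a b => HsOrd.gt a b = true) ∧
      ∀ i, (toDescList s).elem i = sem s i := by
  rw [toDescList_eq_reverse]
  refine ⟨rfl, pairwise_gt_reverse.1 (by rw [List.reverse_reverse]; exact h.pairwise),
    fun i => ?_⟩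
  rw [← elem_toAscList, Bool.eq_iff_iff, elem_iff, elem_iff, List.map_reverse, List.mem_reverse]

theorem Bounded.desc_insert {s t : HSet e} {x : e} {lb ub : Option e} (h : Bounded s lb ub)
    (ht : Denotes t fun k => k = key x ∨ k ∈ keys s) (hlx : isLB lb x = true)
    (hux : isUB ub x = true) :
    Desc t lb ub (if sem s x then size s else 1 + size s) (fun i => i == x || sem s i) := by
  classical
  refine ht.desc ?_ ?_ fun i => by rw [Bool.or_eq_true, beq_iff, sem_iff]
  · rintro k (rfl | hk)
    · exact inBounds_key_iff.2 ⟨hlx, hux⟩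
    · exact h.inBounds k hk
  · rw [h.denotes.size_of_insert ht]
    simp only [sem_iff]

theorem sem_and_lt_iff {s : HSet e} {x i : e} :
    (HsOrd.lt i x && sem s i) = true ↔ key i ∈ keys s ∧ key i < key x := by
  rw [Bool.and_eq_true, lt_iff, sem_iff, and_comm]

theorem sem_and_gt_iff {s : HSet e} {x i : e} :
    (HsOrd.gt i x && sem s i) = true ↔ key i ∈ keys s ∧ key x < key i := by
  rw [Bool.and_eq_true, gt_iff, sem_iff, and_comm]

theorem Bounded.desc_split {s s1 s2 : HSet e} {x : e} {lb ub : Option e} (h : Bounded s lb ub)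
    (h1 : Denotes s1 fun k => k ∈ keys s ∧ k < key x)
    (h2 : Denotes s2 fun k => k ∈ keys s ∧ key x < k) :
    Bounded s1 lb (some x) ∧ Bounded s2 (some x) ub ∧
      Desc s1 lb ub ((toAscList s).countP (fun i => HsOrd.lt i x) : ℤ)
        (fun i => HsOrd.lt i x && sem s i) ∧
      Desc s2 lb ub ((toAscList s).countP (fun i => HsOrd.gt i x) : ℤ)
        (fun i => HsOrd.gt i x && sem s i) :=
  ⟨h1.bounded fun k hk => ⟨(h.inBounds k hk.1).1, by simpa using hk.2⟩,
    h2.bounded fun k hk => ⟨by simpa using hk.2, (h.inBounds k hk.1).2⟩,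
    h1.desc (fun k hk => h.inBounds k hk.1) (h.denotes.size_eq_countP h1 fun _ => lt_iff)
      fun _ => sem_and_lt_iff,
    h2.desc (fun k hk => h.inBounds k hk.1) (h.denotes.size_eq_countP h2 fun _ => gt_iff)
      fun _ => sem_and_gt_iff⟩

theorem Bounded.desc_filter {s t : HSet e} {p : e → Bool} {lb ub : Option e}
    (h : Bounded s lb ub) (ht : Lists t ((toAscList s).filter p)) (hp : Respects p) :
    Desc t lb ub ((toAscList s).countP p : ℤ) (fun i => p i && sem s i) := by
  obtain ⟨h1, h2, h3⟩ := h.desc_of_sublist ht List.filter_sublist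
  refine ⟨h1, by rw [h2, List.countP_eq_length_filter], fun i => ?_⟩
  rw [h3, Bool.eq_iff_iff, elem_iff, Bool.and_eq_true, sem_iff, keys]
  simp only [List.mem_map, List.mem_filter]
  constructor
  · rintro ⟨a, ⟨ha, hpa⟩, hk⟩
    exact ⟨by rw [← hp a i (beq_iff.2 hk), hpa], a, ha, hk⟩
  · rintro ⟨hpi, a, ha, hk⟩
    exact ⟨a, ⟨ha, by rw [hp a i (beq_iff.2 hk), hpi]⟩, hk⟩

theorem mapMonotonic_spec {e' : Type*} [BEq e'] [EquivBEq e'] [HsOrd e'] [OrdLaws e'] {f : e → e'}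
    (hf : ∀ x y, HsOrd.lt x y = true → HsOrd.lt (f x) (f y) = true) {s : HSet e}
    {lb ub : Option e} (h : Bounded s lb ub) :
    toAscList (mapMonotonic f s) = (toAscList s).map f ∧
      Desc (mapMonotonic f s) (lb.map f) (ub.map f) (size s)
        (fun j => ((toAscList s).map f).elem j) ∧
      ((∀ x y, (x == y) = true → (f x == f y) = true) →
        ∀ i, sem (mapMonotonic f s) (f i) = sem s i) := by
  have hL : Lists (mapMonotonic f s) ((toAscList s).map f) :=
    ⟨h.denotes.1.mapMonotonic f, toAscList_mapMonotonic f s⟩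
  have hd := hL.desc (lb := lb.map f) (ub := ub.map f)
    (List.pairwise_map.2 (h.pairwise.imp fun {a b} => hf a b)) fun y hy => by
      obtain ⟨x, hx, rfl⟩ := List.mem_map.1 hy
      obtain ⟨h1, h2⟩ := h.bounds x hx
      constructor
      · cases lb with
        | none => rfl
        | some b => exact hf b x h1
      · cases ub with
        | none => rfl
        | some b => exact hf x b h2
  rw [List.length_map, ← h.size_eq] at hd
  refine ⟨hL.2, hd, fun hfe i => ?_⟩
  rw [hd.2.2, Bool.eq_iff_iff, elem_iff, sem_iff, keys]
  simp only [List.mem_map, exists_exists_and_eq_and]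
  constructor
  · rintro ⟨a, ha, hk⟩
    refine ⟨a, ha, ?_⟩
    rcases lt_trichotomy (key a) (key i) with hlt | heq | hlt
    · exact absurd hk (lt_iff.1 (hf _ _ (lt_iff.2 hlt))).ne
    · exact heq
    · exact absurd hk (lt_iff.1 (hf _ _ (lt_iff.2 hlt))).ne'
  · rintro ⟨a, ha, hk⟩
    exact ⟨a, ha, beq_iff.1 (hfe _ _ (beq_iff.2 hk))⟩

theorem Bounded.desc_take {s t : HSet e} {n : ℤ} {lb ub : Option e} (h : Bounded s lb ub)
    (ht : Lists t ((toAscList s).take n.toNat)) :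
    Desc t lb ub (max 0 (min n (size s))) (fun i => ((toAscList s).take n.toNat).elem i) := by
  obtain ⟨h1, h2, h3⟩ := h.desc_of_sublist ht (List.take_sublist _ _)
  refine ⟨h1, ?_, h3⟩
  rw [h2, List.length_take, h.size_eq]
  omega

theorem Bounded.desc_drop {s t : HSet e} {n : ℤ} {lb ub : Option e} (h : Bounded s lb ub)
    (ht : Lists t ((toAscList s).drop n.toNat)) :
    Desc t lb ub (size s - max 0 (min n (size s)))
      (fun i => ((toAscList s).drop n.toNat).elem i) := by
  obtain ⟨h1, h2, h3⟩ := h.desc_of_sublist ht (List.drop_sublist _ _)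
  refine ⟨h1, ?_, h3⟩
  rw [h2, List.length_drop, h.size_eq]
  omega

variable [HsPrims e]

theorem disjoint_iff {s t : HSet e} (hs : WF s) (ht : WF t) :
    disjoint s t = true ↔ ∀ i, (sem s i && sem t i) = false := by
  rw [hs.denotes.disjoint_iff ht.denotes]
  simp only [← Bool.not_eq_true, Bool.and_eq_true, sem_iff]
  exact ⟨fun h i => h _, fun h k => by
    obtain ⟨i, rfl⟩ := key_surjective k
    exact h i⟩

theorem Bounded.desc_deleteKey {s : HSet e} {lb ub : Option e} (h : Bounded s lb ub) (x : e) :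
    Desc (delete x s) lb ub (if sem s x then size s - 1 else size s)
      (fun i => !(i == x) && sem s i) := by
  classical
  have hd := h.denotes.delete_spec x
  refine hd.desc (fun k hk => h.inBounds k hk.2) ?_ fun _ => not_beq_and_sem_iff
  rw [h.denotes.size_of_erase hd]
  simp only [sem_iff]

theorem minViewSure_view {x : e} {sz : ℤ} {l r : HSet e} {lb ub : Option e}
    (h : Bounded (bin sz x l r) lb ub) {m : e} {t : HSet e} (hm : minViewSure x l r = (m, t)) :
    sem (bin sz x l r) m = true ∧ isLB lb m = true ∧ isUB ub m = true ∧
      Desc t (some m) ub (sz - 1) (fun i => !(i == m) && sem (bin sz x l r) i) := by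
  obtain ⟨h1, h2, h3, -⟩ := subtrees_of_bounded_bin h
  obtain ⟨h4, h5⟩ := minViewSure_spec x h1 h2 h3
  rw [hm] at h4 h5
  exact h.view_of_cons h4 (by rw [toAscList_bin, h5])

theorem maxViewSure_view {x : e} {sz : ℤ} {l r : HSet e} {lb ub : Option e}
    (h : Bounded (bin sz x l r) lb ub) {m : e} {t : HSet e} (hm : maxViewSure x l r = (m, t)) :
    sem (bin sz x l r) m = true ∧ isLB lb m = true ∧ isUB ub m = true ∧
      Desc t lb (some m) (sz - 1) (fun i => !(i == m) && sem (bin sz x l r) i) := by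
  obtain ⟨h1, h2, h3, -⟩ := subtrees_of_bounded_bin h
  obtain ⟨h4, h5⟩ := maxViewSure_spec x h1 h2 h3
  rw [hm] at h4 h5
  exact h.view_of_concat h4 (by rw [toAscList_bin, h5])

theorem Bounded.desc_union {s t : HSet e} {lb ub : Option e} (hs : Bounded s lb ub)
    (ht : Bounded t lb ub) :
    Desc (union s t) lb ub (size s + ((toAscList t).countP (fun i => !sem s i) : ℤ))
      (fun i => sem s i || sem t i) := by
  have hd := hs.denotes.union_spec ht.denotes
  refine hd.desc ?_ ?_ fun i => by rw [Bool.or_eq_true, sem_iff, sem_iff]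
  · rintro k (hk | hk)
    · exact hs.inBounds k hk
    · exact ht.inBounds k hk
  · have hmem : ∀ k, k ∈ ((toAscList t).filter fun i => !sem s i).map key ↔
        k ∈ keys t ∧ k ∉ keys s := by
      intro k
      simp only [List.mem_map, List.mem_filter, keys, Bool.not_eq_true', ← Bool.not_eq_true,
        sem_iff]
      grind
    rw [hd.size_eq_length (xs := keys s ++ ((toAscList t).filter fun i => !sem s i).map key) ?_ ?_,
      List.length_append, List.length_map, ← List.countP_eq_length_filter, Nat.cast_add,
      ← hs.denotes.size_eq_length_keys]
    · exact List.nodup_append.2 ⟨hs.denotes.nodup,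
        ht.denotes.nodup.sublist (List.filter_sublist.map key), fun a ha b hb hab =>
          ((hmem b).1 hb).2 (hab ▸ ha)⟩
    · intro k
      rw [List.mem_append, hmem]
      tauto

theorem desc_unions {ss : List (HSet e)} {lb ub : Option e} (h : ∀ s ∈ ss, Bounded s lb ub) :
    Desc (unions ss) lb ub (distinctCount (ss.flatMap toAscList))
      (fun i => ss.any (fun s => sem s i)) := by
  have hd := (denotes_tip (e := e) (P := fun _ => False) fun _ h => h).foldl_union
    fun s hs => (h s hs).denotes
  refine hd.desc ?_ (hd.size_eq_distinctCount fun k => ?_) fun i => ?_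
  · rintro k (hk | ⟨s, hs, hk⟩)
    · exact hk.elim
    · exact (h s hs).inBounds k hk
  · simp only [List.map_flatMap, List.mem_flatMap, false_or]
    rfl
  · simp only [List.any_eq_true, sem_iff, false_or]

theorem Bounded.desc_difference {s t : HSet e} {lb ub : Option e} (hs : Bounded s lb ub)
    (ht : WF t) :
    Desc (difference s t) lb ub ((toAscList s).countP (fun i => !sem t i) : ℤ)
      (fun i => sem s i && !sem t i) := by
  have hd := hs.denotes.difference_spec ht.denotes
  have hn : ∀ i, (!sem t i) = true ↔ key i ∉ keys t := fun i => by
    rw [Bool.not_eq_true', ← Bool.not_eq_true, sem_iff]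
  exact hd.desc (fun k hk => hs.inBounds k hk.1) (hs.denotes.size_eq_countP hd hn)
    fun i => by rw [Bool.and_eq_true, sem_iff, hn]

theorem Bounded.desc_intersection {s t : HSet e} {lb ub : Option e} (hs : Bounded s lb ub)
    (ht : WF t) :
    Desc (intersection s t) lb ub ((toAscList s).countP (fun i => sem t i) : ℤ)
      (fun i => sem s i && sem t i) := by
  have hd := hs.denotes.intersection_spec ht.denotes
  exact hd.desc (fun k hk => hs.inBounds k hk.1) (hs.denotes.size_eq_countP hd fun _ => sem_iff)
    fun i => by rw [Bool.and_eq_true, sem_iff, sem_iff]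

end Descriptions

end HSet

theorem mainTheorem1 {e : Type*} [BEq e] [EquivBEq e] [HsOrd e] [OrdLaws e] [HsPrims e] :
    -- queries: valid, member, notMember, null, size
    (∀ s : HSet e, HSet.WF s ↔ HSet.valid s = true) ∧
    (∀ (x : e) (s : HSet e), HSet.WF s → HSet.member x s = HSet.sem s x) ∧
    (∀ (x : e) (s : HSet e), HSet.WF s → HSet.notMember x s = !HSet.sem s x) ∧
    (∀ s : HSet e, HSet.WF s → (HSet.null s = true ↔ ∀ i, HSet.sem s i = false)) ∧
    (∀ s : HSet e, HSet.WF s → HSet.size s = ((HSet.toAscList s).length : ℤ)) ∧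
    -- queries: lookupMin, lookupMax, disjoint, isSubsetOf
    (∀ s : HSet e, HSet.WF s →
      (HSet.lookupMin s = none ↔ ∀ i, HSet.sem s i = false) ∧
      ∀ m, HSet.lookupMin s = some m →
        HSet.sem s m = true ∧ ∀ i, HSet.sem s i = true → HsOrd.le m i = true) ∧
    (∀ s : HSet e, HSet.WF s →
      (HSet.lookupMax s = none ↔ ∀ i, HSet.sem s i = false) ∧
      ∀ m, HSet.lookupMax s = some m →
        HSet.sem s m = true ∧ ∀ i, HSet.sem s i = true → HsOrd.le i m = true) ∧
    (∀ s1 s2 : HSet e, HSet.WF s1 → HSet.WF s2 →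
      (HSet.disjoint s1 s2 = true ↔ ∀ i, (HSet.sem s1 i && HSet.sem s2 i) = false)) ∧
    (∀ s1 s2 : HSet e, HSet.WF s1 → HSet.WF s2 →
      (HSet.isSubsetOf s1 s2 = true ↔ ∀ i, HSet.sem s1 i = true → HSet.sem s2 i = true)) ∧
    -- conversions to lists: toAscList, toDescList, toList, elems
    (∀ s : HSet e, HSet.WF s →
      (HSet.toAscList s).Pairwise (fun a b => HsOrd.lt a b = true) ∧
      ∀ i, (HSet.toAscList s).elem i = HSet.sem s i) ∧
    (∀ s : HSet e, HSet.WF s →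
      HSet.toDescList s = (HSet.toAscList s).reverse ∧
      (HSet.toDescList s).Pairwise (fun a b => HsOrd.gt a b = true) ∧
      ∀ i, (HSet.toDescList s).elem i = HSet.sem s i) ∧
    (∀ s : HSet e, HSet.WF s →
      HSet.toList s = HSet.toAscList s ∧ HSet.elems s = HSet.toAscList s) ∧
    -- folds: foldr, foldl, foldr', foldl'
    (∀ {β : Type*} (f : e → β → β) (z : β) (s : HSet e), HSet.WF s →
      HSet.foldr f z s = (HSet.toAscList s).foldr f z ∧
      HSet.foldr' f z s = (HSet.toAscList s).foldr f z) ∧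
    (∀ {β : Type*} (f : β → e → β) (z : β) (s : HSet e), HSet.WF s →
      HSet.foldl f z s = (HSet.toAscList s).foldl f z ∧
      HSet.foldl' f z s = (HSet.toAscList s).foldl f z) ∧
    -- construction: empty, singleton
    (∀ lb ub : Option e, HSet.Desc HSet.empty lb ub 0 (fun _ => false)) ∧
    (∀ (x : e) (lb ub : Option e), HSet.isLB lb x = true → HSet.isUB ub x = true →
      HSet.Desc (HSet.singleton x) lb ub 1 (fun i => i == x)) ∧
    -- balancing: balanceL, balanceR
    (∀ (x : e) (s1 s2 : HSet e) (lb ub : Option e),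
      HSet.Bounded s1 lb (some x) → HSet.Bounded s2 (some x) ub →
      HSet.isLB lb x = true → HSet.isUB ub x = true →
      ((HSet.BalanceStar (HSet.size s1 - 1) (HSet.size s2) ∧ 0 < HSet.size s1) ∨
        HSet.BalanceProp (HSet.size s1) (HSet.size s2) ∨
        HSet.BalanceProp (HSet.size s1) (HSet.size s2 + 1)) →
      HSet.Desc (HSet.balanceL x s1 s2) lb ub (1 + HSet.size s1 + HSet.size s2)
        (fun i => HSet.sem s1 i || i == x || HSet.sem s2 i)) ∧
    (∀ (x : e) (s1 s2 : HSet e) (lb ub : Option e),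
      HSet.Bounded s1 lb (some x) → HSet.Bounded s2 (some x) ub →
      HSet.isLB lb x = true → HSet.isUB ub x = true →
      ((HSet.BalanceStar (HSet.size s2 - 1) (HSet.size s1) ∧ 0 < HSet.size s2) ∨
        HSet.BalanceProp (HSet.size s1) (HSet.size s2) ∨
        HSet.BalanceProp (HSet.size s1 + 1) (HSet.size s2)) →
      HSet.Desc (HSet.balanceR x s1 s2) lb ub (1 + HSet.size s1 + HSet.size s2)
        (fun i => HSet.sem s1 i || i == x || HSet.sem s2 i)) ∧
    -- insertion: insert, insertR, insertMax, insertMin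
    (∀ (x : e) (s : HSet e) (lb ub : Option e), HSet.Bounded s lb ub →
      HSet.isLB lb x = true → HSet.isUB ub x = true →
      HSet.Desc (HSet.insert x s) lb ub
        (if HSet.sem s x then HSet.size s else 1 + HSet.size s)
        (fun i => i == x || HSet.sem s i)) ∧
    (∀ (x : e) (s : HSet e) (lb ub : Option e), HSet.Bounded s lb ub →
      HSet.isLB lb x = true → HSet.isUB ub x = true →
      HSet.Desc (HSet.insertR x s) lb ub
        (if HSet.sem s x then HSet.size s else 1 + HSet.size s)
        (fun i => i == x || HSet.sem s i)) ∧
    (∀ (x : e) (s : HSet e) (lb ub : Option e), HSet.Bounded s lb (some x) →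
      HSet.isLB lb x = true → HSet.isUB ub x = true →
      HSet.Desc (HSet.insertMax x s) lb ub (1 + HSet.size s)
        (fun i => HSet.sem s i || i == x)) ∧
    (∀ (x : e) (s : HSet e) (lb ub : Option e), HSet.Bounded s (some x) ub →
      HSet.isLB lb x = true → HSet.isUB ub x = true →
      HSet.Desc (HSet.insertMin x s) lb ub (1 + HSet.size s)
        (fun i => i == x || HSet.sem s i)) ∧
    -- deletion: delete, deleteMin, deleteMax
    (∀ (x : e) (s : HSet e) (lb ub : Option e), HSet.Bounded s lb ub →
      HSet.Desc (HSet.delete x s) lb ub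
        (if HSet.sem s x then HSet.size s - 1 else HSet.size s)
        (fun i => !(i == x) && HSet.sem s i)) ∧
    (∀ (s : HSet e) (lb ub : Option e), HSet.Bounded s lb ub →
      (HSet.lookupMin s = none → HSet.Desc (HSet.deleteMin s) lb ub 0 (fun _ => false)) ∧
      ∀ m, HSet.lookupMin s = some m →
        HSet.Desc (HSet.deleteMin s) lb ub (HSet.size s - 1)
          (fun i => !(i == m) && HSet.sem s i)) ∧
    (∀ (s : HSet e) (lb ub : Option e), HSet.Bounded s lb ub →
      (HSet.lookupMax s = none → HSet.Desc (HSet.deleteMax s) lb ub 0 (fun _ => false)) ∧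
      ∀ m, HSet.lookupMax s = some m →
        HSet.Desc (HSet.deleteMax s) lb ub (HSet.size s - 1)
          (fun i => !(i == m) && HSet.sem s i)) ∧
    -- views: minViewSure, maxViewSure, minView, maxView
    (∀ (x : e) (sz : ℤ) (l r : HSet e) (lb ub : Option e),
      HSet.Bounded (HSet.bin sz x l r) lb ub →
      ∀ m t, HSet.minViewSure x l r = (m, t) →
        HSet.sem (HSet.bin sz x l r) m = true ∧
        HSet.isLB lb m = true ∧ HSet.isUB ub m = true ∧
        HSet.Desc t (some m) ub (HSet.size l + HSet.size r)
          (fun i => !(i == m) && HSet.sem (HSet.bin sz x l r) i)) ∧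
    (∀ (x : e) (sz : ℤ) (l r : HSet e) (lb ub : Option e),
      HSet.Bounded (HSet.bin sz x l r) lb ub →
      ∀ m t, HSet.maxViewSure x l r = (m, t) →
        HSet.sem (HSet.bin sz x l r) m = true ∧
        HSet.isLB lb m = true ∧ HSet.isUB ub m = true ∧
        HSet.Desc t lb (some m) (HSet.size l + HSet.size r)
          (fun i => !(i == m) && HSet.sem (HSet.bin sz x l r) i)) ∧
    (∀ (s : HSet e) (lb ub : Option e), HSet.Bounded s lb ub →
      (HSet.minView s = none ↔ ∀ i, HSet.sem s i = false) ∧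
      ∀ m t, HSet.minView s = some (m, t) →
        HSet.sem s m = true ∧ HSet.isLB lb m = true ∧ HSet.isUB ub m = true ∧
        HSet.Desc t (some m) ub (HSet.size s - 1) (fun i => !(i == m) && HSet.sem s i)) ∧
    (∀ (s : HSet e) (lb ub : Option e), HSet.Bounded s lb ub →
      (HSet.maxView s = none ↔ ∀ i, HSet.sem s i = false) ∧
      ∀ m t, HSet.maxView s = some (m, t) →
        HSet.sem s m = true ∧ HSet.isLB lb m = true ∧ HSet.isUB ub m = true ∧
        HSet.Desc t lb (some m) (HSet.size s - 1) (fun i => !(i == m) && HSet.sem s i)) ∧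
    -- joining: glue, link, merge
    (∀ (x : e) (s1 s2 : HSet e) (lb ub : Option e),
      HSet.Bounded s1 lb (some x) → HSet.Bounded s2 (some x) ub →
      HSet.isLB lb x = true → HSet.isUB ub x = true →
      HSet.BalanceProp (HSet.size s1) (HSet.size s2) →
      HSet.Desc (HSet.glue s1 s2) lb ub (HSet.size s1 + HSet.size s2)
        (fun i => HSet.sem s1 i || HSet.sem s2 i)) ∧
    (∀ (x : e) (s1 s2 : HSet e) (lb ub : Option e),
      HSet.Bounded s1 lb (some x) → HSet.Bounded s2 (some x) ub →
      HSet.isLB lb x = true → HSet.isUB ub x = true →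
      HSet.Desc (HSet.link x s1 s2) lb ub (1 + HSet.size s1 + HSet.size s2)
        (fun i => HSet.sem s1 i || i == x || HSet.sem s2 i)) ∧
    (∀ (x : e) (s1 s2 : HSet e) (lb ub : Option e),
      HSet.Bounded s1 lb (some x) → HSet.Bounded s2 (some x) ub →
      HSet.isLB lb x = true → HSet.isUB ub x = true →
      HSet.Desc (HSet.merge s1 s2) lb ub (HSet.size s1 + HSet.size s2)
        (fun i => HSet.sem s1 i || HSet.sem s2 i)) ∧
    -- splitting: split, splitMember
    (∀ (x : e) (s : HSet e) (lb ub : Option e), HSet.Bounded s lb ub →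
      ∀ s1 s2, HSet.split x s = (s1, s2) →
        HSet.Bounded s1 lb (some x) ∧ HSet.Bounded s2 (some x) ub ∧
        HSet.Desc s1 lb ub ((HSet.toAscList s).countP (fun i => HsOrd.lt i x) : ℤ)
          (fun i => HsOrd.lt i x && HSet.sem s i) ∧
        HSet.Desc s2 lb ub ((HSet.toAscList s).countP (fun i => HsOrd.gt i x) : ℤ)
          (fun i => HsOrd.gt i x && HSet.sem s i)) ∧
    (∀ (x : e) (s : HSet e) (lb ub : Option e), HSet.Bounded s lb ub →
      ∀ s1 b s2, HSet.splitMember x s = (s1, b, s2) →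
        b = HSet.sem s x ∧
        HSet.Bounded s1 lb (some x) ∧ HSet.Bounded s2 (some x) ub ∧
        HSet.Desc s1 lb ub ((HSet.toAscList s).countP (fun i => HsOrd.lt i x) : ℤ)
          (fun i => HsOrd.lt i x && HSet.sem s i) ∧
        HSet.Desc s2 lb ub ((HSet.toAscList s).countP (fun i => HsOrd.gt i x) : ℤ)
          (fun i => HsOrd.gt i x && HSet.sem s i)) ∧
    -- set operations: union, unions, difference, intersection
    (∀ (s1 s2 : HSet e) (lb ub : Option e), HSet.Bounded s1 lb ub → HSet.Bounded s2 lb ub →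
      HSet.Desc (HSet.union s1 s2) lb ub
        (HSet.size s1 + ((HSet.toAscList s2).countP (fun i => !HSet.sem s1 i) : ℤ))
        (fun i => HSet.sem s1 i || HSet.sem s2 i)) ∧
    (∀ (ss : List (HSet e)) (lb ub : Option e), (∀ s ∈ ss, HSet.Bounded s lb ub) →
      HSet.Desc (HSet.unions ss) lb ub (HSet.distinctCount (ss.flatMap HSet.toAscList))
        (fun i => ss.any (fun s => HSet.sem s i))) ∧
    (∀ (s1 s2 : HSet e) (lb ub : Option e), HSet.Bounded s1 lb ub → HSet.WF s2 →
      HSet.Desc (HSet.difference s1 s2) lb ub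
        ((HSet.toAscList s1).countP (fun i => !HSet.sem s2 i) : ℤ)
        (fun i => HSet.sem s1 i && !HSet.sem s2 i)) ∧
    (∀ (s1 s2 : HSet e) (lb ub : Option e), HSet.Bounded s1 lb ub → HSet.WF s2 →
      HSet.Desc (HSet.intersection s1 s2) lb ub
        ((HSet.toAscList s1).countP (fun i => HSet.sem s2 i) : ℤ)
        (fun i => HSet.sem s1 i && HSet.sem s2 i)) ∧
    -- filter, partition
    (∀ (p : e → Bool) (s : HSet e) (lb ub : Option e), HSet.Bounded s lb ub →
      HSet.Bounded (HSet.filter p s) lb ub ∧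
      HSet.toAscList (HSet.filter p s) = (HSet.toAscList s).filter p ∧
      (HSet.Respects p →
        HSet.Desc (HSet.filter p s) lb ub ((HSet.toAscList s).countP p : ℤ)
          (fun i => p i && HSet.sem s i))) ∧
    (∀ (p : e → Bool) (s : HSet e) (lb ub : Option e), HSet.Bounded s lb ub →
      ∀ s1 s2, HSet.partition p s = (s1, s2) →
        HSet.Bounded s1 lb ub ∧ HSet.Bounded s2 lb ub ∧
        HSet.toAscList s1 = (HSet.toAscList s).filter p ∧
        HSet.toAscList s2 = (HSet.toAscList s).filter (fun i => !p i) ∧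
        (HSet.Respects p →
          HSet.Desc s1 lb ub ((HSet.toAscList s).countP p : ℤ)
            (fun i => p i && HSet.sem s i) ∧
          HSet.Desc s2 lb ub ((HSet.toAscList s).countP (fun i => !p i) : ℤ)
            (fun i => !p i && HSet.sem s i))) ∧
    -- mapMonotonic
    (∀ {e' : Type*} [BEq e'] [EquivBEq e'] [HsOrd e'] [OrdLaws e'] (f : e → e'),
      (∀ x y, HsOrd.lt x y = true → HsOrd.lt (f x) (f y) = true) →
      ∀ (s : HSet e) (lb ub : Option e), HSet.Bounded s lb ub →
        HSet.toAscList (HSet.mapMonotonic f s) = (HSet.toAscList s).map f ∧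
        HSet.Desc (HSet.mapMonotonic f s) (lb.map f) (ub.map f) (HSet.size s)
          (fun j => ((HSet.toAscList s).map f).elem j) ∧
        ((∀ x y, (x == y) = true → (f x == f y) = true) →
          ∀ i, HSet.sem (HSet.mapMonotonic f s) (f i) = HSet.sem s i)) ∧
    -- operations by position: take, drop, splitAt
    (∀ (n : ℤ) (s : HSet e) (lb ub : Option e), HSet.Bounded s lb ub →
      HSet.toAscList (HSet.take n s) = (HSet.toAscList s).take n.toNat ∧
      HSet.Desc (HSet.take n s) lb ub (max 0 (min n (HSet.size s)))
        (fun i => ((HSet.toAscList s).take n.toNat).elem i)) ∧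
    (∀ (n : ℤ) (s : HSet e) (lb ub : Option e), HSet.Bounded s lb ub →
      HSet.toAscList (HSet.drop n s) = (HSet.toAscList s).drop n.toNat ∧
      HSet.Desc (HSet.drop n s) lb ub (HSet.size s - max 0 (min n (HSet.size s)))
        (fun i => ((HSet.toAscList s).drop n.toNat).elem i)) ∧
    (∀ (n : ℤ) (s : HSet e) (lb ub : Option e), HSet.Bounded s lb ub →
      ∀ s1 s2, HSet.splitAt n s = (s1, s2) →
        HSet.toAscList s1 = (HSet.toAscList s).take n.toNat ∧
        HSet.toAscList s2 = (HSet.toAscList s).drop n.toNat ∧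
        HSet.Desc s1 lb ub (max 0 (min n (HSet.size s)))
          (fun i => ((HSet.toAscList s).take n.toNat).elem i) ∧
        HSet.Desc s2 lb ub (HSet.size s - max 0 (min n (HSet.size s)))
          (fun i => ((HSet.toAscList s).drop n.toNat).elem i)) ∧
    -- combineEq
    (∀ xs : List e,
      (HSet.combineEq xs).Sublist xs ∧
      (∀ i, (HSet.combineEq xs).elem i = xs.elem i) ∧
      (xs.Pairwise (fun a b => HsOrd.le a b = true) →
        (HSet.combineEq xs).Pairwise (fun a b => HsOrd.lt a b = true)) ∧
      (xs.Pairwise (fun a b => HsOrd.ge a b = true) →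
        (HSet.combineEq xs).Pairwise (fun a b => HsOrd.gt a b = true))) ∧
    -- fromDistinctAscList, fromDistinctDescList, fromAscList, fromDescList:
    -- they terminate on every list, and are correct on sorted ones
    (∀ xs : List e, ∃ s, HSet.Returns (fun n => HSet.fromDistinctAscList n xs) s ∧
      (xs.Pairwise (fun a b => HsOrd.lt a b = true) →
        HSet.toAscList s = xs ∧
        ∀ lb ub : Option e, (∀ x ∈ xs, HSet.isLB lb x = true ∧ HSet.isUB ub x = true) →
          HSet.Desc s lb ub (xs.length : ℤ) (fun i => xs.elem i))) ∧
    (∀ xs : List e, ∃ s, HSet.Returns (fun n => HSet.fromDistinctDescList n xs) s ∧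
      (xs.Pairwise (fun a b => HsOrd.gt a b = true) →
        HSet.toDescList s = xs ∧
        ∀ lb ub : Option e, (∀ x ∈ xs, HSet.isLB lb x = true ∧ HSet.isUB ub x = true) →
          HSet.Desc s lb ub (xs.length : ℤ) (fun i => xs.elem i))) ∧
    (∀ xs : List e, ∃ s, HSet.Returns (fun n => HSet.fromAscList n xs) s ∧
      (xs.Pairwise (fun a b => HsOrd.le a b = true) →
        ∀ lb ub : Option e, (∀ x ∈ xs, HSet.isLB lb x = true ∧ HSet.isUB ub x = true) →
          HSet.Desc s lb ub (HSet.distinctCount xs) (fun i => xs.elem i))) ∧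
    (∀ xs : List e, ∃ s, HSet.Returns (fun n => HSet.fromDescList n xs) s ∧
      (xs.Pairwise (fun a b => HsOrd.ge a b = true) →
        ∀ lb ub : Option e, (∀ x ∈ xs, HSet.isLB lb x = true ∧ HSet.isUB ub x = true) →
          HSet.Desc s lb ub (HSet.distinctCount xs) (fun i => xs.elem i))) := by
  open HSet in
  refine ⟨wf_iff_valid, fun x s h => member_eq_sem h x,
    fun x s h => by rw [notMember, member_eq_sem h], fun s _ => ?_, fun s h => h.size_eq,
    fun s h => lookupMin_spec h, fun s h => lookupMax_spec h, fun s t hs ht => disjoint_iff hs ht,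
    fun s t hs ht => (hs.denotes.isSubsetOf_iff ht.denotes).trans forall_sem_iff,
    fun s h => ⟨h.pairwise, elem_toAscList s⟩, fun s h => toDescList_spec h,
    fun _ _ => ⟨rfl, rfl⟩, fun f z s _ => ⟨foldr_eq f z s, foldr'_eq f z s⟩,
    fun f z s _ => ⟨foldl_eq f z s, foldl'_eq f z s⟩, desc_tip, ?_, ?_, ?_, ?_, ?_, ?_, ?_,
    fun x s lb ub h => h.desc_deleteKey x, ?_, ?_, ?_, ?_, ?_, ?_, ?_, ?_, ?_, ?_, ?_,
    fun s t lb ub hs ht => hs.desc_union ht, fun ss lb ub h => desc_unions h,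
    fun s t lb ub hs ht => hs.desc_difference ht, fun s t lb ub hs ht => hs.desc_intersection ht,
    ?_, ?_, fun f hf s lb ub h => mapMonotonic_spec hf h, ?_, ?_, ?_, ?_, ?_, ?_, ?_, ?_⟩
  · rw [← HSet.eq_tip_iff]
    cases s <;> simp [HSet.null]
  · intro x lb ub hlx hux
    simpa [HSet.sem] using HSet.desc_of_join (t := HSet.singleton x) (l := .tip) (r := .tip)
      (HSet.lists_singleton x) (.tip _ _) (.tip _ _) hlx hux
  · intro x s t lb ub hs ht hlx hux hbal
    exact HSet.desc_of_join (hs.denotes.lists.balanceL ht.denotes.lists hbal) hs ht hlx hux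
  · intro x s t lb ub hs ht hlx hux hbal
    exact HSet.desc_of_join (hs.denotes.lists.balanceR ht.denotes.lists hbal) hs ht hlx hux
  · exact fun x s lb ub h => h.desc_insert (h.denotes.insert_spec x)
  · exact fun x s lb ub h => h.desc_insert (h.denotes.insertR_spec x)
  · intro x s lb ub h hlx hux
    simpa [HSet.sem] using HSet.desc_of_join (r := .tip) (HSet.lists_insertMax x h.denotes.1) h
      (.tip _ _) hlx hux
  · intro x s lb ub h hlx hux
    simpa [HSet.sem] using HSet.desc_of_join (l := .tip) (HSet.lists_insertMin x h.denotes.1)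
      (.tip _ _) h hlx hux
  · refine fun s lb ub h => ⟨fun hm => ?_, fun m hm => ?_⟩
    · rw [HSet.lookupMin_eq_none hm]
      exact HSet.desc_tip _ _
    · have ht := HSet.lists_deleteMin h.denotes.1
      exact h.desc_delete_of_cons ht.1 (by rw [ht.2, ← HSet.lookupMin_eq_some hm])
  · refine fun s lb ub h => ⟨fun hm => ?_, fun m hm => ?_⟩
    · rw [HSet.lookupMax_eq_none hm]
      exact HSet.desc_tip _ _
    · have ht := HSet.lists_deleteMax h.denotes.1
      exact h.desc_delete_of_concat ht.1 (by rw [ht.2, ← HSet.lookupMax_eq_some hm])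
  · intro x sz l r lb ub h m t hm
    rw [(HSet.subtrees_of_bounded_bin h).2.2.2]
    exact HSet.minViewSure_view h hm
  · intro x sz l r lb ub h m t hm
    rw [(HSet.subtrees_of_bounded_bin h).2.2.2]
    exact HSet.maxViewSure_view h hm
  · intro s lb ub h
    rw [← HSet.eq_tip_iff]
    cases s with
    | tip => simp [HSet.minView]
    | bin sz x l r =>
      exact ⟨by simp [HSet.minView], fun m t hm => HSet.minViewSure_view h (Option.some.inj hm)⟩
  · intro s lb ub h
    rw [← HSet.eq_tip_iff]
    cases s with
    | tip => simp [HSet.maxView]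
    | bin sz x l r =>
      exact ⟨by simp [HSet.maxView], fun m t hm => HSet.maxViewSure_view h (Option.some.inj hm)⟩
  · intro x s t lb ub hs ht hlx hux hbal
    exact HSet.desc_of_append (HSet.lists_glue hs.denotes.1 ht.denotes.1 hbal) hs ht hlx hux
  · intro x s t lb ub hs ht hlx hux
    exact HSet.desc_of_join (HSet.lists_link x hs.denotes.1 ht.denotes.1) hs ht hlx hux
  · intro x s t lb ub hs ht hlx hux
    exact HSet.desc_of_append (HSet.lists_merge hs.denotes.1 ht.denotes.1) hs ht hlx hux
  · intro x s lb ub h s1 s2 hsp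
    obtain ⟨h1, h2⟩ := h.denotes.splitS_spec x
    rw [← HSet.split, hsp] at h1 h2
    exact h.desc_split h1 h2
  · intro x s lb ub h s1 b s2 hsp
    obtain ⟨h1, hb, h2⟩ := h.denotes.splitMember_spec x
    rw [hsp] at h1 hb h2
    exact ⟨by rw [Bool.eq_iff_iff, hb, HSet.sem_iff], h.desc_split h1 h2⟩
  · intro p s lb ub h
    have ht := HSet.lists_filter p h.denotes.1
    exact ⟨(h.desc_of_sublist ht List.filter_sublist).1, ht.2, h.desc_filter ht⟩
  · intro p s lb ub h s1 s2 hp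
    obtain ⟨h1, h2⟩ := HSet.lists_partition p h.denotes.1
    rw [hp] at h1 h2
    exact ⟨(h.desc_of_sublist h1 List.filter_sublist).1,
      (h.desc_of_sublist h2 List.filter_sublist).1, h1.2, h2.2,
      fun hr => ⟨h.desc_filter h1 hr, h.desc_filter h2 (HSet.respects_not hr)⟩⟩
  · intro n s lb ub h
    have ht := HSet.lists_take n h.denotes.1
    exact ⟨ht.2, h.desc_take ht⟩
  · intro n s lb ub h
    have ht := HSet.lists_drop n h.denotes.1
    exact ⟨ht.2, h.desc_drop ht⟩
  · intro n s lb ub h s1 s2 hsp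
    rw [HSet.splitAt_eq, Prod.mk.injEq] at hsp
    have h1 := HSet.lists_take n h.denotes.1
    have h2 := HSet.lists_drop n h.denotes.1
    rw [hsp.1] at h1
    rw [hsp.2] at h2
    exact ⟨h1.2, h2.2, h.desc_take h1, h.desc_drop h2⟩
  · refine fun xs => ⟨HSet.combineEq_sublist xs, fun i => ?_, HSet.pairwise_lt_combineEq,
      HSet.pairwise_gt_combineEq⟩
    rw [Bool.eq_iff_iff, HSet.elem_iff, HSet.elem_iff, HSet.mem_map_key_combineEq]
  · intro xs
    obtain ⟨t, ht, hL⟩ := HSet.fromDistinctAscList_spec xs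
    exact ⟨t, ht, fun hs => ⟨hL.2, fun lb ub hb => hL.desc hs hb⟩⟩
  · intro xs
    obtain ⟨t, ht, hL⟩ := HSet.fromDistinctDescList_spec xs
    refine ⟨t, ht, fun hs => ⟨by rw [HSet.toDescList_eq_reverse, hL.2, List.reverse_reverse],
      fun lb ub hb => ?_⟩⟩
    obtain ⟨h1, h2, h3⟩ := hL.desc (HSet.pairwise_gt_reverse.2 hs) fun x hx =>
      hb x (List.mem_reverse.1 hx)
    refine ⟨h1, by rw [h2, List.length_reverse], fun i => ?_⟩
    rw [h3, Bool.eq_iff_iff, HSet.elem_iff, HSet.elem_iff, List.map_reverse, List.mem_reverse]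
  · intro xs
    obtain ⟨t, ht, hL⟩ := HSet.fromDistinctAscList_spec (HSet.combineEq xs)
    exact ⟨t, ht, fun hs lb ub hb => hL.desc_distinctCount (HSet.pairwise_lt_combineEq hs)
      (fun k => HSet.mem_map_key_combineEq k xs) hb⟩
  · intro xs
    obtain ⟨t, ht, hL⟩ := HSet.fromDistinctDescList_spec (HSet.combineEq xs)
    exact ⟨t, ht, fun hs lb ub hb => hL.desc_distinctCount
      (HSet.pairwise_gt_reverse.2 (HSet.pairwise_gt_combineEq hs))
      (fun k => by rw [List.map_reverse, List.mem_reverse, HSet.mem_map_key_combineEq]) hb⟩
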